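/- Work in the triangular grid, whose edges are positively directed along three directions $a,b,c$ with $a+b+c=0$ (the projections of the unit vectors of $\mathbb Z^3$ along $(1,1,1)$), so that the three sides of every triangle form a directed cycle. Let $\mathcal D$ be a finite union of triangles that can be tiled by lozenges (unions of two adjacent triangles). A height function $h_T$ of a tiling $T$ is a function on vertices that increases by $1$ along each positively directed edge of $\mathcal D$ that does not cut a lozenge of $T$. Assume that $\mathcal D$ is a polygon (connected with connected complement) or, more generally, that any two tilings of $\mathcal D$ have height functions that coincide on the contour of $\mathcal D$. With heights so normalized, order the tilings by $T\preccurlyeq T'$ iff $h_T\le h_{T'}$ at every vertex of $\mathcal D$; $\mathrm{Min}(\mathcal D)$ and $\mathrm{Max}(\mathcal D)$ are the least and greatest tilings. A seed of $T$ is a hexagon of side $1$ on which $T$ induces the minimal tiling; it is located by its center and the height of that center. A pseudo-hexagon of $T$ with seed $s$ is given by a nonempty finite compact pile $P$ of unit cubes (a finite lower set of $\mathbb N^3$, with corner at $s$) such that the projections of the cubes of $P$ on the three base planes are lozenges of $T$; these lozenges form its minimal tiling. The range $r_T(s)$ is the union of the pseudo-hexagons of $T$ with seed $s$. The maximum range $R(s)$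 is the set of all cubes of the piles of pseudo-hexagons with seed $s$, over all tilings of $\mathcal D$ in which $s$ appears. A seed $s$ of $T$ is a proper seed of $T$ if $R(s)\subseteq R(s')$ holds for no seed $s'\neq s$ of $T$. Let $\mathcal D^0=\mathrm{Min}(\mathcal D)$. The proper seeds of order $n$ are the proper seeds of $\mathcal D^n$, and $\mathcal D^{n+1}$ is obtained from $\mathcal D^n$ by filling them maximally: on the range in $\mathcal D^n$ of each of them $\mathcal D^{n+1}$ is the maximal tiling of that range, and elsewhere it coincides with $\mathcal D^n$. (So $\mathcal D^n$ is obtained by maximally filling all proper seeds of order less than $n$.) Then the sequence $(\mathcal D^n)_{n\ge 0}$ exists and is unique; there is a least integer $d=d(\mathcal D)$ with $\mathcal D^{d}=\mathrm{Max}(\mathcal D)$; and the intervals $[\mathcal D^n,\mathcal D^{n+1}]$, $0\le n<d$, form a maximal chain of intervals running from $\mathrm{Min}(\mathcal D)$ to $\mathrm{Max}(\mathcal D)$. That is, $\mathcal D^0=\mathrm{Min}(\mathcal D)$, $\mathcal D^d=\mathrm{Max}(\mathcal D)$, $\mathcal D^n\prec\mathcal D^{n+1}$ for $0\le n<d$,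 and these intervals form a maximal chain in the set of intervals $[x,y]$ with $x\prec y$, where $[x,y]$ lies below $[x',y']$ when $y\preccurlyeq x'$. -/

import Mathlib

/-! Lozenge tilings of finite domains of the triangular grid. -/

namespace LozengeTiling

/-- Vertices of the triangular grid, in the lattice basis given by two of the three directions. -/
abbrev Vertex := ℤ × ℤ

/-- The three positive directions `a, b, c` of the grid; their sum is `0`.  They are the images of
the three unit vectors of `ℤ³` under the projection along `(1,1,1)`. -/
def dir : Fin 3 → Vertex := ![(1, 0), (0, 1), (-1, -1)]

/-- The positively directed edge `(v, i)` goes from `v` to `v + dir i`. -/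
abbrev Edge := Vertex × Fin 3

/-- The triangles of the grid: `(v, false)` has vertices `v, v + a, v + a + b`
and `(v, true)` has vertices `v, v + b, v + b + a`. -/
abbrev Tri := Vertex × Bool

/-- The vertices of a triangle. -/
def triVertices : Tri → Finset Vertex
  | (v, false) => {v, v + dir 0, v + dir 0 + dir 1}
  | (v, true) => {v, v + dir 1, v + dir 1 + dir 0}

/-- The sides of a triangle; positively directed, they form a cycle. -/
def triEdges : Tri → Finset Edge
  | (v, false) => {(v, 0), (v + dir 0, 1), (v + dir 0 + dir 1, 2)}
  | (v, true) => {(v, 1), (v + dir 1, 0), (v + dir 1 + dir 0, 2)}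

/-- A domain: a finite union of triangles of the grid. -/
abbrev Domain := Finset Tri

/-- `v` is a vertex of the domain. -/
def IsVertexOf (D : Domain) (v : Vertex) : Prop := ∃ t ∈ D, v ∈ triVertices t

/-- The contour: the edges that belong to exactly one triangle of the domain. -/
def IsContourEdge (D : Domain) (e : Edge) : Prop := ∃! t : Tri, t ∈ D ∧ e ∈ triEdges t

/-- The vertices that lie on the contour. -/
def IsContourVertex (D : Domain) (v : Vertex) : Prop :=
  ∃ e : Edge, IsContourEdge D e ∧ (v = e.1 ∨ v = e.1 + dir e.2)

/-- A polygon: a domain which is connected (as a closed subset of the plane, so triangles that share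
a vertex are connected) and whose complement is connected (as an open subset of the plane, so
triangles of the complement are connected through common sides). -/
def IsPolygon (D : Domain) : Prop :=
  (∀ t ∈ D, ∀ t' ∈ D, Relation.ReflTransGen
    (fun x y : Tri => x ∈ D ∧ y ∈ D ∧ ∃ v, v ∈ triVertices x ∧ v ∈ triVertices y) t t') ∧
  (∀ t, t ∉ D → ∀ t', t' ∉ D → Relation.ReflTransGen
    (fun x y : Tri => x ∉ D ∧ y ∉ D ∧ ∃ e, e ∈ triEdges x ∧ e ∈ triEdges y) t t')

/-- A lozenge is the union of the two triangles that share a given side; it is encoded by that side,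
which is the short diagonal of the lozenge. -/
abbrev Lozenge := Edge

/-- The lozenge is included in the domain. -/
def LozengeIn (l : Lozenge) (D : Domain) : Prop := ∀ t : Tri, l ∈ triEdges t → t ∈ D

/-- A tiling of `D`: lozenges included in `D` such that every triangle of `D` belongs to exactly one
of them. -/
@[ext]
structure Tiling (D : Domain) where
  lozenges : Finset Lozenge
  subset : ∀ l ∈ lozenges, LozengeIn l D
  cover : ∀ t ∈ D, ∃! l : Lozenge, l ∈ lozenges ∧ l ∈ triEdges t

variable {D : Domain}

/-- `h` is a height function of `T`: it increases by one along every positively directed edge of the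
domain that is valid for `T`, that is, that does not cut a lozenge of `T`. -/
def Tiling.IsHeight (T : Tiling D) (h : Vertex → ℤ) : Prop :=
  ∀ t ∈ D, ∀ e ∈ triEdges t, e ∉ T.lozenges → h (e.1 + dir e.2) = h e.1 + 1

/-- Two functions take the same values on the contour of `D`. -/
def AgreeOnContour (D : Domain) (h h' : Vertex → ℤ) : Prop :=
  ∀ v, IsContourVertex D v → h v = h' v

/-- The heights of the tilings of `D` are consistent: any two tilings have height functions that take
the same values on the contour. -/
def HasConsistentHeights (D : Domain) : Prop :=
  ∀ T T' : Tiling D, ∃ h h' : Vertex → ℤ,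
    T.IsHeight h ∧ T'.IsHeight h' ∧ AgreeOnContour D h h'

/-- The order on tilings: `T ≤ T'` when the height function of `T` is at most the one of `T'`, the
two being normalized so as to coincide on the contour. -/
instance : LE (Tiling D) where
  le T T' := ∃ h h' : Vertex → ℤ, T.IsHeight h ∧ T'.IsHeight h' ∧ AgreeOnContour D h h' ∧
    ∀ v, IsVertexOf D v → h v ≤ h' v

/-- `T` is the minimal tiling `Min(D)`. -/
def Tiling.IsMinimal (T : Tiling D) : Prop := ∀ T' : Tiling D, T ≤ T'

/-- `T` is the maximal tiling `Max(D)`. -/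
def Tiling.IsMaximal (T : Tiling D) : Prop := ∀ T' : Tiling D, T' ≤ T

/-! ### Cubes, pseudo-hexagons, seeds and their ranges -/

/-- A cube of `ℤ³`, encoded by the projection and the height of its lowest corner. -/
abbrev Cube := Vertex × ℤ

/-- A compact pile of cubes, in coordinates relative to the corner `0` (nonempty, so that it contains
the cube at the corner). -/
def IsCompactPile (P : Finset (Fin 3 → ℕ)) : Prop :=
  P.Nonempty ∧ IsLowerSet (P : Set (Fin 3 → ℕ))

/-- The projection of the point `p` of `ℤ³`, relative to an origin that projects onto `v`. -/
def point (v : Vertex) (p : Fin 3 → ℕ) : Vertex := v + ∑ j, p j • dir j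

/-- The lozenges of the minimal tiling of the pseudo-hexagon defined by the pile `P` with corner `v`:
the projections of the cubes of `P` onto the three base planes.  The unit square of `ℤ³` with lowest
corner above `u`, orthogonal to the axis `i`, is seen as the lozenge `(u - dir i, i)`. -/
def baseLozenges (v : Vertex) (P : Finset (Fin 3 → ℕ)) : Set Lozenge :=
  {l | ∃ p ∈ P, ∃ i : Fin 3, l = (point v (Function.update p i 0) - dir i, i)}

/-- The hexagon of side 1 with center `v` carries a seed in `T`, i.e. `T` induces its minimal
tiling. -/
def Tiling.HasSeed (T : Tiling D) (v : Vertex) : Prop := ∀ i : Fin 3, (v - dir i, i) ∈ T.lozenges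

/-- The pseudo-hexagon with seed at `v` defined by the compact pile `P` lies in the tiling `T`, on
which the cubes of `P` can therefore be piled. -/
def Tiling.HasPseudoHexagon (T : Tiling D) (v : Vertex) (P : Finset (Fin 3 → ℕ)) : Prop :=
  IsCompactPile P ∧ baseLozenges v P ⊆ T.lozenges

open Classical in
/-- The range of the seed at `v` in `T`: the union of the pseudo-hexagons of `T` with this seed. -/
noncomputable def Tiling.range (T : Tiling D) (v : Vertex) : Domain :=
  D.filter fun t => ∃ P, T.HasPseudoHexagon v P ∧ ∃ l ∈ baseLozenges v P, l ∈ triEdges t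

/-- The maximum range of the seed whose center is `s.1`, at height `s.2`, when heights on the contour
are normalized by `h`: the cubes that belong to its range in some tiling of `D`. -/
def maxRange (D : Domain) (h : Vertex → ℤ) (s : Cube) : Set Cube :=
  {c | ∃ (T : Tiling D) (k : Vertex → ℤ), T.IsHeight k ∧ AgreeOnContour D h k ∧ k s.1 = s.2 ∧
    ∃ P, T.HasPseudoHexagon s.1 P ∧ ∃ p ∈ P, c = (point s.1 p, s.2 + ∑ j, (p j : ℤ))}

/-- The tiling `T` has a proper seed at `v`: a seed whose maximum range is included in the maximum
range of no other seed of `T`. -/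
def Tiling.HasProperSeed (T : Tiling D) (v : Vertex) : Prop :=
  T.HasSeed v ∧ ∃ h : Vertex → ℤ, T.IsHeight h ∧
    ∀ v', T.HasSeed v' → maxRange D h (v, h v) ⊆ maxRange D h (v', h v') → v' = v

/-- `T'` is obtained from `T` by maximally filling the ranges of all the proper seeds of `T`: on each
of these ranges `T'` is the maximal tiling of the range, and elsewhere `T'` coincides with `T`. -/
def Tiling.IsMaxFilling (T T' : Tiling D) : Prop :=
  (∀ v, T.HasProperSeed v →
    ∃ U : Tiling (T.range v), U.IsMaximal ∧ U.lozenges ⊆ T'.lozenges) ∧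
  (∀ l ∈ T.lozenges, (∀ v, T.HasProperSeed v → ¬ LozengeIn l (T.range v)) → l ∈ T'.lozenges)

/-- `E n` is the tiling `Dⁿ`: `E 0` is the minimal tiling; the proper seeds of order `n` are the
proper seeds of `E n`; and `E (n + 1)` is obtained when those are maximally filled as well. -/
def IsFillingSequence (E : ℕ → Tiling D) : Prop :=
  (E 0).IsMinimal ∧ ∀ n, (E n).IsMaxFilling (E (n + 1))

/-- An interval `[lo, hi]` of the ordered set of tilings, not reduced to a single tiling. -/
structure TilingInterval (D : Domain) where
  lo : Tiling D
  hi : Tiling D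
  le : lo ≤ hi
  ne : lo ≠ hi

/-- The interval `I` lies below the interval `J` (they may share an end). -/
def TilingInterval.Precedes (I J : TilingInterval D) : Prop := I.hi ≤ J.lo

end LozengeTiling

open LozengeTiling

namespace LozengeTiling

/-! A tiling is the same thing as a height function, up to constants: an integer function with
increments `1` or `-2` along the edges of `D`, and `1` on the contour; the lozenges are the edges of
increment `-2`. With equal contour values two height functions differ by multiples of `3`, so their
minimum is again a height function. A seed can be flipped by raising its center by `3`, and a tiling
without seed is the greatest one (`isMaximal_of_not_hasSeed`). Hence `Min` and `Max` exist. For a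
polygon, consistency of heights comes from integrating increments, using that the complement is
connected (`IsPolygon.hasConsistentHeights`).

The combinatorial core is that ranges of distinct seeds of one tiling are disjoint
(`Tiling.HasSeed.eq_of_mem_range`) and that each range has consistent heights itself
(`HasConsistentHeights.range`). So each range has a unique maximal tiling, all ranges of proper
seeds can be refilled independently, and maximal filling is a well-defined map which does not
decrease tilings.

This map strictly increases every tiling `T` other than `Max`. Such a `T` has a seed, and a seed
whose maximum range is maximal for inclusion is proper (`Tiling.exists_hasProperSeed`). Its range
contains its hexagon, while the maximal tiling of that range has no seed. As there are finitely many
tilings, iteration from `Min` reaches `Max`. The chain of intervals is maximal because consecutive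
intervals share an end and together they run from `Min` to `Max` (`isMaxChain_of_filling`). -/

variable {D : Domain}

/-! ### Edges, triangles, contour -/

/-- The increment of a function along a positively directed edge. -/
def inc (h : Vertex → ℤ) (e : Edge) : ℤ := h (e.1 + dir e.2) - h e.1

/-- The side of direction `i` of a triangle. -/
def triEdge : Tri → Fin 3 → Edge
  | (v, false) => ![(v, 0), (v + dir 0, 1), (v + dir 0 + dir 1, 2)]
  | (v, true) => ![(v + dir 1, 0), (v, 1), (v + dir 1 + dir 0, 2)]

/-- The two triangles that share an edge. -/
def edgeTri (e : Edge) (b : Bool) : Tri :=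
  (bif b then ![e.1 - dir 1, e.1, e.1 - dir 1 - dir 0] e.2
    else ![e.1, e.1 - dir 0, e.1 - dir 0 - dir 1] e.2, b)

lemma mem_triEdges_iff {e : Edge} {t : Tri} : e ∈ triEdges t ↔ e = triEdge t e.2 := by
  obtain ⟨⟨x, y⟩, i⟩ := e
  obtain ⟨⟨z, w⟩, b⟩ := t
  fin_cases i <;> cases b <;> simp [triEdges, triEdge, dir]

lemma mem_triEdges_iff_edgeTri {e : Edge} {t : Tri} : e ∈ triEdges t ↔ t = edgeTri e t.2 := by
  obtain ⟨⟨x, y⟩, i⟩ := e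
  obtain ⟨⟨z, w⟩, b⟩ := t
  fin_cases i <;> cases b <;> simp [triEdges, edgeTri, dir] <;> omega

lemma triEdge_snd (t : Tri) (i : Fin 3) : (triEdge t i).2 = i := by
  obtain ⟨⟨z, w⟩, b⟩ := t
  fin_cases i <;> cases b <;> rfl

lemma triEdge_mem (t : Tri) (i : Fin 3) : triEdge t i ∈ triEdges t := by
  rw [mem_triEdges_iff, triEdge_snd]

lemma mem_triEdges_edgeTri (e : Edge) (b : Bool) : e ∈ triEdges (edgeTri e b) := by
  rw [mem_triEdges_iff_edgeTri]; rfl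

lemma fst_mem_triVertices {e : Edge} {t : Tri} (h : e ∈ triEdges t) : e.1 ∈ triVertices t := by
  obtain ⟨⟨x, y⟩, i⟩ := e
  obtain ⟨⟨z, w⟩, b⟩ := t
  fin_cases i <;> cases b <;> simp [triEdges, triVertices, dir] at h ⊢ <;> omega

lemma snd_mem_triVertices {e : Edge} {t : Tri} (h : e ∈ triEdges t) :
    e.1 + dir e.2 ∈ triVertices t := by
  obtain ⟨⟨x, y⟩, i⟩ := e
  obtain ⟨⟨z, w⟩, b⟩ := t
  fin_cases i <;> cases b <;> simp [triEdges, triVertices, dir] at h ⊢ <;> omega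

lemma exists_triEdge_fst {v : Vertex} {t : Tri} (h : v ∈ triVertices t) :
    ∃ i, (triEdge t i).1 = v := by
  obtain ⟨⟨z, w⟩, b⟩ := t
  cases b
  · simp only [triVertices, Finset.mem_insert, Finset.mem_singleton] at h
    rcases h with rfl | rfl | rfl
    exacts [⟨0, rfl⟩, ⟨1, rfl⟩, ⟨2, rfl⟩]
  · simp only [triVertices, Finset.mem_insert, Finset.mem_singleton] at h
    rcases h with rfl | rfl | rfl
    exacts [⟨1, rfl⟩, ⟨0, rfl⟩, ⟨2, rfl⟩]

/-- The three sides form a directed cycle, so the sum telescopes. -/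
lemma sum_inc_triEdge (h : Vertex → ℤ) (t : Tri) :
    inc h (triEdge t 0) + inc h (triEdge t 1) + inc h (triEdge t 2) = 0 := by
  obtain ⟨⟨z, w⟩, b⟩ := t
  cases b <;> simp [inc, triEdge, dir]

/-- A predicate on vertices that holds only in the domain and propagates along one direction is
empty, since the domain is finite. -/
lemma not_of_walk (j : Fin 3) (p : Vertex → Prop) (hp : ∀ v, p v → IsVertexOf D v ∧ p (v + dir j))
    (v : Vertex) : ¬ p v := by
  intro hv
  have h1 : ∀ n : ℕ, p (v + n • dir j) := by
    intro n
    induction n with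
    | zero => simpa using hv
    | succ n ih => rw [succ_nsmul, ← add_assoc]; exact (hp _ ih).2
  have hinj : Function.Injective fun n : ℕ => v + n • dir j := by
    intro m n hmn
    have := add_left_cancel hmn
    fin_cases j <;> simp [dir] at this <;> omega
  refine Set.infinite_range_of_injective hinj ((D.biUnion triVertices).finite_toSet.subset ?_)
  rintro _ ⟨n, rfl⟩
  obtain ⟨t, ht, h⟩ := (hp _ (h1 n)).1
  simp only [Finset.coe_biUnion, Set.mem_iUnion]
  exact ⟨t, ht, h⟩

lemma isContourEdge_of_mem_of_notMem {e : Edge} {t t' : Tri} (h : e ∈ triEdges t)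
    (h' : e ∈ triEdges t') (ht : t ∈ D) (ht' : t' ∉ D) : IsContourEdge D e := by
  refine ⟨t, ⟨ht, h⟩, ?_⟩
  rintro s ⟨hs, hes⟩
  rw [mem_triEdges_iff_edgeTri] at h h' hes
  have h1 : t.2 ≠ t'.2 := fun hb => ht' (by rw [h', ← hb, ← h]; exact ht)
  have h2 : s.2 ≠ t'.2 := fun hb => ht' (by rw [h', ← hb, ← hes]; exact hs)
  have : s.2 = t.2 := by
    revert h1 h2; cases s.2 <;> cases t.2 <;> cases t'.2 <;> simp
  rw [hes, this, ← h]

lemma IsContourEdge.exists_notMem {e : Edge} (h : IsContourEdge D e) :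
    ∃ t, t ∉ D ∧ e ∈ triEdges t := by
  by_contra! hc
  have h1 : ∀ b, edgeTri e b ∈ D := fun b => by
    by_contra hb; exact hc _ hb (mem_triEdges_edgeTri e b)
  have := h.unique ⟨h1 false, mem_triEdges_edgeTri e _⟩ ⟨h1 true, mem_triEdges_edgeTri e _⟩
  simpa [edgeTri] using congrArg Prod.snd this

lemma mem_triVertices_iff {v : Vertex} {t : Tri} : v ∈ triVertices t ↔
    t ∈ ({(v, false), (v - dir 1, true), (v - dir 0 - dir 1, false), (v - dir 0 - dir 1, true),
      (v - dir 0, false), (v, true)} : Finset Tri) := by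
  obtain ⟨⟨z, w⟩, b⟩ := t
  obtain ⟨x, y⟩ := v
  cases b <;> simp [triVertices, dir] <;> omega

/-- A vertex of the domain that is not on the contour is surrounded by the domain. -/
lemma mem_of_not_isContourVertex {v : Vertex} (hv : IsVertexOf D v) (hc : ¬ IsContourVertex D v)
    {t : Tri} (ht : v ∈ triVertices t) : t ∈ D := by
  have key : ∀ e : Edge, (v = e.1 ∨ v = e.1 + dir e.2) → ∀ s s', e ∈ triEdges s → e ∈ triEdges s' →
      s ∈ D → s' ∈ D := by
    intro e he s s' h h' hs
    by_contra hs'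
    exact hc ⟨e, isContourEdge_of_mem_of_notMem h h' hs hs', he⟩
  have key' : ∀ e : Edge, (v = e.1 ∨ v = e.1 + dir e.2) → ∀ s s', e ∈ triEdges s → e ∈ triEdges s' →
      (s ∈ D ↔ s' ∈ D) :=
    fun e he s s' h h' => ⟨key e he s s' h h', key e he s' s h' h⟩
  -- `h1` to `h5` turn around `v`: each crosses an edge at `v` separating two successive triangles
  -- among the six.
  have h1 := key' (v, 0) (by simp) (v, false) (v - dir 1, true) (by simp [triEdges])
    (by simp [triEdges])
  have h2 := key' (v - dir 1, 1) (by simp) (v - dir 1, true) (v - dir 0 - dir 1, false)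
    (by simp [triEdges]) (by simp [triEdges]; abel)
  have h3 := key' (v, 2) (by simp) (v - dir 0 - dir 1, false) (v - dir 0 - dir 1, true)
    (by simp [triEdges]; abel) (by simp [triEdges])
  have h4 := key' (v - dir 0, 0) (by simp) (v - dir 0 - dir 1, true) (v - dir 0, false)
    (by simp [triEdges]) (by simp [triEdges])
  have h5 := key' (v, 1) (by simp) (v - dir 0, false) (v, true)
    (by simp [triEdges]) (by simp [triEdges])
  have hall : ∀ s, v ∈ triVertices s → ((v, false) ∈ D ↔ s ∈ D) := by
    intro s hs
    rw [mem_triVertices_iff] at hs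
    simp only [Finset.mem_insert, Finset.mem_singleton] at hs
    rcases hs with rfl | rfl | rfl | rfl | rfl | rfl
    exacts [Iff.rfl, h1, h1.trans h2, (h1.trans h2).trans h3, ((h1.trans h2).trans h3).trans h4,
      (((h1.trans h2).trans h3).trans h4).trans h5]
  obtain ⟨s, hs, hvs⟩ := hv
  exact (hall t ht).1 ((hall s hvs).2 hs)

lemma IsContourVertex.exists_notMem {v : Vertex} (h : IsContourVertex D v) :
    ∃ t, t ∉ D ∧ v ∈ triVertices t := by
  obtain ⟨e, he, hv⟩ := h
  obtain ⟨t, ht, het⟩ := he.exists_notMem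
  refine ⟨t, ht, ?_⟩
  rcases hv with rfl | rfl
  exacts [fst_mem_triVertices het, snd_mem_triVertices het]

lemma IsContourVertex.isVertexOf {v : Vertex} (h : IsContourVertex D v) : IsVertexOf D v := by
  obtain ⟨e, ⟨t, ⟨ht, het⟩, -⟩, hv⟩ := h
  refine ⟨t, ht, ?_⟩
  rcases hv with rfl | rfl
  exacts [fst_mem_triVertices het, snd_mem_triVertices het]

/-- A property of vertices that holds on the contour and propagates backwards along the edges of the
domain holds at all vertices of the domain. -/
lemma vertex_induction {p : Vertex → Prop} (hc : ∀ v, IsContourVertex D v → p v)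
    (he : ∀ t ∈ D, ∀ e ∈ triEdges t, p (e.1 + dir e.2) → p e.1) {v : Vertex}
    (hv : IsVertexOf D v) : p v := by
  by_contra hpv
  -- A counterexample is not on the contour, so the next vertex in direction `0` is still in the
  -- domain, and it is a counterexample too.
  refine not_of_walk (D := D) 0 (fun v => IsVertexOf D v ∧ ¬ p v) ?_ v ⟨hv, hpv⟩
  rintro u ⟨hu, hpu⟩
  have ht : (u, false) ∈ D :=
    mem_of_not_isContourVertex hu (fun h => hpu (hc u h)) (by simp [triVertices])
  exact ⟨hu, ⟨_, ht, by simp [triVertices]⟩, fun h => hpu (he _ ht (u, 0) (by simp [triEdges]) h)⟩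

/-! ### Height functions -/

lemma Tiling.eq_of_mem (T : Tiling D) {t : Tri} (ht : t ∈ D) {l l' : Lozenge}
    (hl : l ∈ T.lozenges) (hl' : l' ∈ T.lozenges) (h : l ∈ triEdges t) (h' : l' ∈ triEdges t) :
    l = l' :=
  (T.cover t ht).unique ⟨hl, h⟩ ⟨hl', h'⟩

lemma Tiling.exists_tri (T : Tiling D) {l : Lozenge} (hl : l ∈ T.lozenges) :
    ∃ t ∈ D, l ∈ triEdges t :=
  ⟨_, T.subset l hl _ (mem_triEdges_edgeTri l false), mem_triEdges_edgeTri l false⟩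

lemma Tiling.eq_of_subset {T T' : Tiling D} (h : T.lozenges ⊆ T'.lozenges) : T = T' := by
  refine Tiling.ext (h.antisymm fun l hl => ?_)
  obtain ⟨t, ht, hlt⟩ := T'.exists_tri hl
  obtain ⟨l', ⟨hl', hlt'⟩, -⟩ := T.cover t ht
  rwa [T'.eq_of_mem ht hl (h hl') hlt hlt']

/-- Consecutive edges of different directions are sides of a common triangle. -/
lemma exists_tri_of_consecutive (w : Vertex) {i k : Fin 3} (hik : i ≠ k) :
    ∃ t, (w - dir i, i) ∈ triEdges t ∧ (w, k) ∈ triEdges t := by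
  obtain ⟨x, y⟩ := w
  refine ⟨edgeTri ((x, y), k) (decide (k = i + 2)), ?_, mem_triEdges_edgeTri _ _⟩
  fin_cases i <;> fin_cases k <;> first | exact absurd rfl hik | simp [triEdges, edgeTri, dir]

/-- A tiling does not cut two consecutive edges of different directions. -/
lemma Tiling.not_consecutive (T : Tiling D) {w : Vertex} {i k : Fin 3} (hik : i ≠ k)
    (h : (w - dir i, i) ∈ T.lozenges) (h' : (w, k) ∈ T.lozenges) : False := by
  obtain ⟨t, h1, h2⟩ := exists_tri_of_consecutive w hik
  exact hik (congrArg Prod.snd (T.eq_of_mem (T.subset _ h _ h1) h h' h1 h2))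

/-- The two uncut sides of a triangle contribute `1` each to a zero sum, which leaves `-2` for the
cut one. -/
lemma Tiling.IsHeight.inc_eq {T : Tiling D} {h : Vertex → ℤ} (hT : T.IsHeight h) {t : Tri}
    (ht : t ∈ D) {e : Edge} (he : e ∈ triEdges t) :
    inc h e = if e ∈ T.lozenges then -2 else 1 := by
  have h1 : ∀ e ∈ triEdges t, e ∉ T.lozenges → inc h e = 1 := fun e he hn => by
    rw [inc, hT t ht e he hn]; ring
  split_ifs with heT
  · have h2 : ∀ i, i ≠ e.2 → inc h (triEdge t i) = 1 := fun i hi =>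
      h1 _ (triEdge_mem t i) fun hm =>
        hi (by rw [← T.eq_of_mem ht hm heT (triEdge_mem t i) he, triEdge_snd])
    have h3 := sum_inc_triEdge h t
    rw [mem_triEdges_iff] at he
    rw [he]
    generalize e.2 = j at h2
    fin_cases j
    · have := h2 1 (by simp); have := h2 2 (by simp); simp only [Fin.zero_eta]; omega
    · have := h2 0 (by simp); have := h2 2 (by simp); simp only [Fin.mk_one]; omega
    · have := h2 0 (by simp); have := h2 1 (by simp); simp only [Fin.reduceFinMk]; omega
  · exact h1 e he heT

lemma Tiling.isHeight_iff {T : Tiling D} {h : Vertex → ℤ} : T.IsHeight h ↔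
    ∀ t ∈ D, ∀ e ∈ triEdges t, inc h e = if e ∈ T.lozenges then -2 else 1 := by
  refine ⟨fun hT t ht e he => hT.inc_eq ht he, fun hT t ht e he hn => ?_⟩
  have := hT t ht e he
  rw [if_neg hn, inc] at this
  omega

lemma Tiling.IsHeight.inc_eq_one_or {T : Tiling D} {h : Vertex → ℤ} (hT : T.IsHeight h) {t : Tri}
    (ht : t ∈ D) {e : Edge} (he : e ∈ triEdges t) : inc h e = 1 ∨ inc h e = -2 := by
  rw [hT.inc_eq ht he]; split_ifs <;> simp

lemma Tiling.notMem_of_isContourEdge (T : Tiling D) {e : Edge} (he : IsContourEdge D e) :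
    e ∉ T.lozenges := by
  intro h
  obtain ⟨t, ht, het⟩ := he.exists_notMem
  exact ht (T.subset e h t het)

/-- A function whose increments are `1` or `-2`, and `1` on the contour, is a height function. -/
lemma exists_tiling_of_inc {h : Vertex → ℤ}
    (hi : ∀ t ∈ D, ∀ e ∈ triEdges t, inc h e = 1 ∨ inc h e = -2)
    (hc : ∀ e, IsContourEdge D e → inc h e = 1) : ∃ T : Tiling D, T.IsHeight h := by
  classical
  have hmem : ∀ t ∈ D, ∀ e ∈ triEdges t,
      (e ∈ (D.biUnion triEdges).filter (fun e => inc h e = -2) ↔ inc h e = -2) := by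
    intro t ht e he
    simp only [Finset.mem_filter, Finset.mem_biUnion, and_iff_right_iff_imp]
    exact fun _ => ⟨t, ht, he⟩
  refine ⟨⟨(D.biUnion triEdges).filter fun e => inc h e = -2, ?_, ?_⟩, ?_⟩
  · intro l hl t hlt
    simp only [Finset.mem_filter, Finset.mem_biUnion] at hl
    obtain ⟨⟨s, hs, hls⟩, hl⟩ := hl
    by_contra ht
    rw [hc l (isContourEdge_of_mem_of_notMem hls hlt hs ht)] at hl
    omega
  · intro t ht
    have h3 := sum_inc_triEdge h t
    -- Three numbers equal to `1` or `-2` with sum zero include `-2` exactly once.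
    have hx : ∃! i, inc h (triEdge t i) = -2 := by
      have h0 := hi t ht _ (triEdge_mem t 0)
      have h1 := hi t ht _ (triEdge_mem t 1)
      have h2 := hi t ht _ (triEdge_mem t 2)
      rcases h0 with h0 | h0
      · rcases h1 with h1 | h1
        · refine ⟨2, by omega, fun j hj => ?_⟩
          fin_cases j <;> simp_all
        · refine ⟨1, by omega, fun j hj => ?_⟩
          have : inc h (triEdge t 2) = 1 := by omega
          fin_cases j <;> simp_all
      · refine ⟨0, by omega, fun j hj => ?_⟩
        have : inc h (triEdge t 2) = 1 := by omega
        have : inc h (triEdge t 1) = 1 := by omega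
        fin_cases j <;> simp_all
    obtain ⟨i, hi1, hi2⟩ := hx
    refine ⟨triEdge t i, ⟨(hmem t ht _ (triEdge_mem t i)).2 hi1, triEdge_mem t i⟩, ?_⟩
    rintro l ⟨hl, hlt⟩
    have h4 := (hmem t ht l hlt).1 hl
    rw [mem_triEdges_iff] at hlt
    rw [hlt] at h4
    rw [hlt, hi2 _ h4]
  · rw [Tiling.isHeight_iff]
    intro t ht e he
    show inc h e = if e ∈ (D.biUnion triEdges).filter (fun e => inc h e = -2) then -2 else 1
    simp only [hmem t ht e he]
    rcases hi t ht e he with h | h <;> simp [h]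

lemma Tiling.eq_of_height_eq {T T' : Tiling D} {h h' : Vertex → ℤ} (hT : T.IsHeight h)
    (hT' : T'.IsHeight h') (he : ∀ v, IsVertexOf D v → h v = h' v) : T = T' := by
  refine Tiling.eq_of_subset fun l hl => ?_
  obtain ⟨t, ht, hlt⟩ := T.exists_tri hl
  have h1 := hT.inc_eq ht hlt
  have h2 := hT'.inc_eq ht hlt
  rw [if_pos hl] at h1
  by_contra hl'
  rw [if_neg hl'] at h2
  rw [inc, he _ ⟨t, ht, fst_mem_triVertices hlt⟩, he _ ⟨t, ht, snd_mem_triVertices hlt⟩] at h1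
  rw [inc] at h2
  omega

/-- Two functions with the same increments on the domain and the same values on the contour are
equal on the domain. -/
lemma eq_of_inc_eq {h h' : Vertex → ℤ} (hi : ∀ t ∈ D, ∀ e ∈ triEdges t, inc h e = inc h' e)
    (hc : AgreeOnContour D h h') {v : Vertex} (hv : IsVertexOf D v) : h v = h' v := by
  refine vertex_induction (p := fun v => h v = h' v) hc ?_ hv
  intro t ht e he h1
  have := hi t ht e he
  rw [inc, inc] at this
  omega

lemma Tiling.IsHeight.inc_eq_inc {T : Tiling D} {h h' : Vertex → ℤ} (hT : T.IsHeight h)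
    (hT' : T.IsHeight h') {t : Tri} (ht : t ∈ D) {e : Edge} (he : e ∈ triEdges t) :
    inc h e = inc h' e := by
  rw [hT.inc_eq ht he, hT'.inc_eq ht he]

/-- Renormalization of a height function. -/
lemma Tiling.IsHeight.renormalize {T T' : Tiling D} {h k k' : Vertex → ℤ} (hT : T.IsHeight h)
    (hk : T.IsHeight k) (hk' : T'.IsHeight k') : T'.IsHeight fun v => k' v + h v - k v := by
  rw [Tiling.isHeight_iff] at hk' ⊢
  intro t ht e he
  rw [← hk' t ht e he]
  have := hT.inc_eq_inc hk ht he
  simp only [inc] at this ⊢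
  omega

/-- The order can be tested with any normalization. -/
lemma Tiling.le_of_le {T T' : Tiling D} (hle : T ≤ T') {h h' : Vertex → ℤ} (hT : T.IsHeight h)
    (hT' : T'.IsHeight h') (hc : AgreeOnContour D h h') {v : Vertex} (hv : IsVertexOf D v) :
    h v ≤ h' v := by
  obtain ⟨k, k', hk, hk', hkc, hkle⟩ := hle
  have h1 : h' v = k' v + h v - k v := by
    refine eq_of_inc_eq (fun t ht e he => hT'.inc_eq_inc (hT.renormalize hk hk') ht he) ?_ hv
    intro u hu
    have := hc u hu
    have := hkc u hu
    show h' u = k' u + h u - k u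
    omega
  have := hkle v hv
  omega

lemma Tiling.le_trans' {T T' T'' : Tiling D} (h1 : T ≤ T') (h2 : T' ≤ T'') : T ≤ T'' := by
  obtain ⟨h, h', hT, hT', hc, hle⟩ := h1
  obtain ⟨k, k', hk, hk', hkc, hkle⟩ := h2
  refine ⟨h, _, hT, hT'.renormalize hk hk', fun v hv => ?_, fun v hv => ?_⟩
  · have := hc v hv
    have := hkc v hv
    show h v = k' v + h' v - k v
    omega
  · have := hle v hv
    have := hkle v hv
    show h v ≤ k' v + h' v - k v
    omega

lemma Tiling.le_antisymm' {T T' : Tiling D} (h1 : T ≤ T') (h2 : T' ≤ T) : T = T' := by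
  obtain ⟨h, h', hT, hT', hc, hle⟩ := h1
  refine Tiling.eq_of_height_eq hT hT' fun v hv => (hle v hv).antisymm ?_
  exact Tiling.le_of_le h2 hT' hT (fun u hu => (hc u hu).symm) hv

lemma Tiling.le_refl_of_isHeight {T : Tiling D} {h : Vertex → ℤ} (hT : T.IsHeight h) : T ≤ T :=
  ⟨h, h, hT, hT, fun _ _ => rfl, fun _ _ => le_rfl⟩

instance : Finite (Tiling D) := by
  classical
  refine Finite.of_injective
    (fun T : Tiling D => (⟨T.lozenges, ?_⟩ : {s // s ∈ (D.biUnion triEdges).powerset})) ?_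
  · rw [Finset.mem_powerset]
    intro l hl
    simpa using T.exists_tri hl
  · intro T T' h
    exact Tiling.ext (congrArg Subtype.val h)

/-- The tilings of a domain with consistent heights, as a partial order. -/
abbrev HasConsistentHeights.partialOrder (hD : HasConsistentHeights D) :
    PartialOrder (Tiling D) where
  le := (· ≤ ·)
  le_refl T := by
    obtain ⟨h, -, hT, -⟩ := hD T T
    exact Tiling.le_refl_of_isHeight hT
  le_trans _ _ _ := Tiling.le_trans'
  le_antisymm _ _ := Tiling.le_antisymm'

lemma HasConsistentHeights.exists_isHeight (hD : HasConsistentHeights D) (T : Tiling D) :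
    ∃ h, T.IsHeight h := by
  obtain ⟨h, -, hT, -⟩ := hD T T
  exact ⟨h, hT⟩

/-! ### Flips, minimal and maximal tilings -/

/-- The three lozenges of a seed cover the six triangles around its center; hence the center of a
seed is interior to `D`. -/
lemma mem_triVertices_of_seed {v : Vertex} {t : Tri} (ht : v ∈ triVertices t) :
    ∃ i : Fin 3, (v - dir i, i) ∈ triEdges t := by
  obtain ⟨⟨z, w⟩, b⟩ := t
  obtain ⟨x, y⟩ := v
  cases b <;> simp [triVertices, triEdges, dir, Fin.exists_fin_succ] at ht ⊢ <;> omega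

lemma Tiling.HasSeed.mem {T : Tiling D} {v : Vertex} (hs : T.HasSeed v) {t : Tri}
    (ht : v ∈ triVertices t) : t ∈ D := by
  obtain ⟨i, hi⟩ := mem_triVertices_of_seed ht
  exact T.subset _ (hs i) _ hi

lemma Tiling.HasSeed.isVertexOf {T : Tiling D} {v : Vertex} (hs : T.HasSeed v) :
    IsVertexOf D v :=
  ⟨(v, false), hs.mem (by simp [triVertices]), by simp [triVertices]⟩

lemma Tiling.HasSeed.not_isContourVertex {T : Tiling D} {v : Vertex} (hs : T.HasSeed v) :
    ¬ IsContourVertex D v := by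
  intro hc
  obtain ⟨t, ht, hv⟩ := hc.exists_notMem
  exact ht (hs.mem hv)

lemma add_dir_ne (v : Vertex) (i : Fin 3) : v + dir i ≠ v := by
  fin_cases i <;> simp [dir]

/-- A seed can be flipped. -/
lemma Tiling.HasSeed.exists_flip {T : Tiling D} {v : Vertex} (hs : T.HasSeed v)
    {h : Vertex → ℤ} (hT : T.IsHeight h) : ∃ T' : Tiling D, T ≤ T' ∧ T ≠ T' := by
  have hout : ∀ k, (v, k) ∉ T.lozenges := fun k hk => by
    obtain ⟨i, hi⟩ := exists_ne k
    exact T.not_consecutive hi (hs i) hk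
  have hup : ∀ u, h u ≤ Function.update h v (h v + 3) u := fun u => by
    by_cases hu : u = v
    · subst hu; simp
    · simp [hu]
  -- The edges into `v` are cut and those out of `v` are not. Raising `v` by `3` turns the former
  -- increments from `-2` into `1` and the latter from `1` into `-2`.
  have hinc : ∀ t ∈ D, ∀ e ∈ triEdges t, (inc (Function.update h v (h v + 3)) e = inc h e) ∨
      (inc (Function.update h v (h v + 3)) e = 1 ∨ inc (Function.update h v (h v + 3)) e = -2) := by
    intro t ht e he
    have h0 := hT.inc_eq ht he
    by_cases h1 : e.1 = v
    · have h2 : e.1 + dir e.2 ≠ v := by rw [h1]; exact add_dir_ne v _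
      have h3 : e ∉ T.lozenges := fun h => hout e.2 (by rw [← h1]; exact h)
      rw [if_neg h3] at h0
      right; right
      rw [inc] at h0 ⊢
      rw [Function.update_of_ne h2, h1, Function.update_self]
      rw [h1] at h0
      omega
    · by_cases h2 : e.1 + dir e.2 = v
      · have h3 : e ∈ T.lozenges := by
          have := hs e.2
          rwa [← h2, add_sub_cancel_right] at this
        rw [if_pos h3] at h0
        right; left
        rw [inc] at h0 ⊢
        rw [Function.update_of_ne h1, h2, Function.update_self]
        rw [h2] at h0
        omega
      · left
        rw [inc, inc, Function.update_of_ne h1, Function.update_of_ne h2]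
  obtain ⟨T', hT'⟩ : ∃ T' : Tiling D, T'.IsHeight (Function.update h v (h v + 3)) := by
    refine exists_tiling_of_inc (fun t ht e he => ?_) fun e he => ?_
    · rcases hinc t ht e he with h1 | h1
      · rw [h1]; exact hT.inc_eq_one_or ht he
      · exact h1
    · have h0 := T.notMem_of_isContourEdge he
      have h1 : e.1 ≠ v := fun h => hs.not_isContourVertex ⟨e, he, Or.inl h.symm⟩
      have h2 : e.1 + dir e.2 ≠ v := fun h => hs.not_isContourVertex ⟨e, he, Or.inr h.symm⟩
      obtain ⟨t, ⟨ht, het⟩, -⟩ := he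
      have h3 := hT.inc_eq ht het
      rw [if_neg h0] at h3
      rw [← h3, inc, inc, Function.update_of_ne h1, Function.update_of_ne h2]
  have hag : AgreeOnContour D h (Function.update h v (h v + 3)) := fun u hu => by
    rw [Function.update_of_ne]
    rintro rfl
    exact hs.not_isContourVertex hu
  refine ⟨T', ⟨h, _, hT, hT', hag, fun u _ => hup u⟩, ?_⟩
  rintro rfl
  have := eq_of_inc_eq (fun t ht e he => hT.inc_eq_inc hT' ht he) hag hs.isVertexOf
  simp at this

/-- A tiling without seed is maximal. -/
lemma isMaximal_of_not_hasSeed (hD : HasConsistentHeights D) {T : Tiling D}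
    (hT : ∀ v, ¬ T.HasSeed v) : T.IsMaximal := by
  intro T'
  obtain ⟨h', h, hT', hTh, hc⟩ := hD T' T
  refine ⟨h', h, hT', hTh, hc, ?_⟩
  by_contra! hcon
  obtain ⟨w, hw, hlt⟩ := hcon
  have hfin : {v | IsVertexOf D v}.Finite := by
    refine (D.biUnion triVertices).finite_toSet.subset fun v hv => ?_
    simp only [Finset.coe_biUnion, Set.mem_iUnion]
    obtain ⟨t, ht, h⟩ := hv
    exact ⟨t, ht, h⟩
  -- Extremal choice: `v` has the least height `h` among the vertices where the excess `h' - h` is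
  -- largest. This excess is positive, so `v` is interior, and `v` will carry a seed of `T`.
  obtain ⟨m, hm, hmax⟩ := hfin.exists_maximalFor (fun v => h' v - h v) _ ⟨w, hw⟩
  obtain ⟨v, ⟨hv, hvm⟩, hmin⟩ := (hfin.subset (Set.sep_subset _
    fun v => h' v - h v = h' m - h m)).exists_minimalFor h _ ⟨m, hm, rfl⟩
  have hmax' : ∀ u, IsVertexOf D u → h' u - h u ≤ h' m - h m := fun u hu => by
    by_contra! hlt
    exact absurd (hmax hu hlt.le) (not_le.2 hlt)
  have hpos := hmax' w hw
  have hint : ¬ IsContourVertex D v := fun hcv => by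
    have := hc v hcv
    omega
  refine hT v fun i => ?_
  have ht : edgeTri (v - dir i, i) false ∈ D := by
    have := snd_mem_triVertices (mem_triEdges_edgeTri (v - dir i, i) false)
    rw [sub_add_cancel] at this
    exact mem_of_not_isContourVertex hv hint this
  have he := mem_triEdges_edgeTri (v - dir i, i) false
  -- If the edge into `v` were uncut, `h` would be lower by `1` at its origin and the excess there
  -- would be the same or larger by `3`, against the choice of `v`.
  by_contra hn
  have h1 := hTh.inc_eq ht he
  have h2 := hT'.inc_eq_one_or ht he
  rw [if_neg hn] at h1
  have hu : IsVertexOf D (v - dir i) := ⟨_, ht, fst_mem_triVertices he⟩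
  simp only [inc, sub_add_cancel] at h1 h2
  have h3 := hmax' _ hu
  have h4 := hmin (j := v - dir i) ⟨hu, by omega⟩ (by omega)
  omega

lemma Tiling.IsMaximal.not_hasSeed (hD : HasConsistentHeights D) {T : Tiling D}
    (hT : T.IsMaximal) (v : Vertex) : ¬ T.HasSeed v := by
  intro hs
  obtain ⟨h, hh⟩ := hD.exists_isHeight T
  obtain ⟨T', hle, hne⟩ := hs.exists_flip hh
  exact hne (Tiling.le_antisymm' hle (hT T'))

/-- A maximal element of the finite order admits no flip, so it has no seed and is the greatest
element. -/
lemma HasConsistentHeights.exists_isMaximal (hD : HasConsistentHeights D)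
    [Nonempty (Tiling D)] : ∃ T : Tiling D, T.IsMaximal := by
  let := hD.partialOrder
  obtain ⟨T, -, hT⟩ := (Set.toFinite (Set.univ : Set (Tiling D))).exists_maximal Set.univ_nonempty
  refine ⟨T, isMaximal_of_not_hasSeed hD fun v hs => ?_⟩
  obtain ⟨h, hh⟩ := hD.exists_isHeight T
  obtain ⟨T', hle, hne⟩ := hs.exists_flip hh
  exact hne (Tiling.le_antisymm' hle (hT (Set.mem_univ T') hle))

/-- Height functions are determined modulo `3` by their values on the contour. -/
lemma Tiling.IsHeight.dvd_sub {T T' : Tiling D} {h h' : Vertex → ℤ} (hT : T.IsHeight h)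
    (hT' : T'.IsHeight h') (hc : AgreeOnContour D h h') {v : Vertex} (hv : IsVertexOf D v) :
    3 ∣ h' v - h v := by
  refine vertex_induction (p := fun v => 3 ∣ h' v - h v) (fun v hv => by simp [hc v hv]) ?_ hv
  intro t ht e he h1
  have h2 := hT.inc_eq_one_or ht he
  have h3 := hT'.inc_eq_one_or ht he
  simp only [inc] at h2 h3
  omega

/-- The tilings of a domain have pairwise lower bounds. -/
lemma HasConsistentHeights.exists_le_le (hD : HasConsistentHeights D) (T T' : Tiling D) :
    ∃ M : Tiling D, M ≤ T ∧ M ≤ T' := by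
  obtain ⟨h, h', hT, hT', hc⟩ := hD T T'
  -- The difference `h' - h` is a multiple of `3` and changes by `0` or `±3` along an edge, so it
  -- cannot jump across `0`: on each edge the minimum follows one of the two functions.
  obtain ⟨M, hM⟩ : ∃ M : Tiling D, M.IsHeight fun v => min (h v) (h' v) := by
    refine exists_tiling_of_inc (fun t ht e he => ?_) fun e he => ?_
    · have h1 := hT.inc_eq_one_or ht he
      have h2 := hT'.inc_eq_one_or ht he
      have h3 := hT.dvd_sub hT' hc ⟨t, ht, fst_mem_triVertices he⟩
      simp only [inc] at h1 h2 ⊢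
      omega
    · have h1 := T.notMem_of_isContourEdge he
      have h2 := T'.notMem_of_isContourEdge he
      have h3 := hc _ ⟨e, he, Or.inl rfl⟩
      obtain ⟨t, ⟨ht, het⟩, -⟩ := he
      have h4 := hT.inc_eq ht het
      have h5 := hT'.inc_eq ht het
      rw [if_neg h1] at h4
      rw [if_neg h2] at h5
      simp only [inc] at h4 h5 ⊢
      omega
  refine ⟨M, ⟨_, h, hM, hT, fun v hv => ?_, fun v _ => min_le_left _ _⟩,
    ⟨_, h', hM, hT', fun v hv => ?_, fun v _ => min_le_right _ _⟩⟩
  · simp [hc v hv]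
  · simp [hc v hv]

lemma HasConsistentHeights.exists_isMinimal (hD : HasConsistentHeights D)
    [Nonempty (Tiling D)] : ∃ T : Tiling D, T.IsMinimal := by
  let := hD.partialOrder
  obtain ⟨T, -, hT⟩ := (Set.toFinite (Set.univ : Set (Tiling D))).exists_minimal Set.univ_nonempty
  refine ⟨T, fun T' => ?_⟩
  obtain ⟨M, h1, h2⟩ := hD.exists_le_le T T'
  exact Tiling.le_trans' (hT (Set.mem_univ M) h1) h2

lemma Tiling.IsMaximal.eq {T T' : Tiling D} (h : T.IsMaximal) (h' : T'.IsMaximal) : T = T' :=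
  Tiling.le_antisymm' (h' T) (h T')

lemma Tiling.IsMinimal.eq {T T' : Tiling D} (h : T.IsMinimal) (h' : T'.IsMinimal) : T = T' :=
  Tiling.le_antisymm' (h T') (h' T)

/-! ### Polygons have consistent heights -/

/-- The circulation of a function on edges around a triangle. -/
def circ (w : Edge → ℤ) (t : Tri) : ℤ :=
  w (triEdge t 0) + w (triEdge t 1) + w (triEdge t 2)

lemma circ_congr {w w' : Edge → ℤ} {t : Tri} (h : ∀ e ∈ triEdges t, w e = w' e) :
    circ w t = circ w' t := by
  rw [circ, circ, h _ (triEdge_mem t 0), h _ (triEdge_mem t 1), h _ (triEdge_mem t 2)]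

/-- The value of a function on one side of a triangle can be changed to cancel the circulation. -/
lemma exists_update_circ_eq_zero (w : Edge → ℤ) {t : Tri} {e : Edge} (he : e ∈ triEdges t) :
    ∃ z, circ (Function.update w e z) t = 0 := by
  refine ⟨w e - circ w t, ?_⟩
  obtain ⟨w', hw'⟩ : ∃ w', w' = Function.update w e (w e - circ w t) := ⟨_, rfl⟩
  have hne : ∀ i, i ≠ e.2 → w' (triEdge t i) = w (triEdge t i) := fun i hi => by
    rw [hw', Function.update_of_ne fun h => hi (by rw [← h, triEdge_snd])]
  have heq : w' (triEdge t e.2) = w (triEdge t e.2) - circ w t := by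
    rw [hw', ← mem_triEdges_iff.1 he, Function.update_self]
  rw [← hw', circ]
  rw [circ] at heq
  generalize e.2 = j at hne heq
  fin_cases j
  · have h1 := hne 1 (by simp)
    have h2 := hne 2 (by simp)
    simp only [Fin.zero_eta] at heq
    omega
  · have h1 := hne 0 (by simp)
    have h2 := hne 2 (by simp)
    simp only [Fin.mk_one] at heq
    omega
  · have h1 := hne 0 (by simp)
    have h2 := hne 1 (by simp)
    simp only [Fin.reduceFinMk] at heq
    omega

/-- When the complement of `D` is connected, a function on edges without circulation on `D` can be
modified outside `D` to be without circulation on a larger finite domain. -/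
lemma exists_extension
    (hD : ∀ t, t ∉ D → ∀ t', t' ∉ D → Relation.ReflTransGen
      (fun x y : Tri => x ∉ D ∧ y ∉ D ∧ ∃ e, e ∈ triEdges x ∧ e ∈ triEdges y) t t')
    {w : Edge → ℤ} (hw : ∀ t ∈ D, circ w t = 0) (n : ℕ) :
    ∀ B : Domain, D ⊆ B → (B \ D).card = n →
      ∃ w' : Edge → ℤ, (∀ t ∈ B, circ w' t = 0) ∧ ∀ t ∈ D, ∀ e ∈ triEdges t, w' e = w e := by
  induction n with
  | zero =>
    intro B hDB hn
    rw [Finset.card_eq_zero, Finset.sdiff_eq_empty_iff_subset] at hn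
    exact ⟨w, fun t ht => hw t (hn ht), fun _ _ _ _ => rfl⟩
  | succ n ih =>
    intro B hDB hn
    obtain ⟨t₀, ht₀⟩ : (B \ D).Nonempty := by rw [← Finset.card_pos]; omega
    rw [Finset.mem_sdiff] at ht₀
    obtain ⟨t₁, ht₁⟩ := Infinite.exists_notMem_finset B
    -- A path outside `D` from `t₀` to `t₁` must leave `B`, crossing an edge `e`. Among the
    -- triangles of `B` only `x` has the side `e`, so after treating `B.erase x` the value at `e` is
    -- free to correct the circulation of `x`.
    obtain ⟨x, y, hx, hxD, hy, e, hex, hey⟩ : ∃ x y, x ∈ B ∧ x ∉ D ∧ y ∉ B ∧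
        ∃ e, e ∈ triEdges x ∧ e ∈ triEdges y := by
      by_contra! hcon
      have : ∀ t, Relation.ReflTransGen
          (fun x y : Tri => x ∉ D ∧ y ∉ D ∧ ∃ e, e ∈ triEdges x ∧ e ∈ triEdges y) t₀ t → t ∈ B := by
        intro t ht
        induction ht with
        | refl => exact ht₀.1
        | tail _ h ihx =>
          obtain ⟨h1, h2, e, h3, h4⟩ := h
          by_contra hy
          exact hcon _ _ ihx h1 hy e h3 h4
      exact ht₁ (this t₁ (hD t₀ ht₀.2 t₁ fun h => ht₁ (hDB h)))
    have hDx : D ⊆ B.erase x := fun t ht =>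
      Finset.mem_erase.2 ⟨fun h => hxD (h ▸ ht), hDB ht⟩
    obtain ⟨w', hw', hww'⟩ := ih (B.erase x) hDx (by
      rw [Finset.erase_sdiff_comm, Finset.card_erase_of_mem (Finset.mem_sdiff.2 ⟨hx, hxD⟩), hn]
      rfl)
    have hnot : ∀ t ∈ B.erase x, e ∉ triEdges t := fun t ht het => by
      obtain ⟨htx, htB⟩ := Finset.mem_erase.1 ht
      exact htx ((isContourEdge_of_mem_of_notMem hex hey hx hy).unique ⟨htB, het⟩ ⟨hx, hex⟩)
    obtain ⟨z, hz⟩ := exists_update_circ_eq_zero w' hex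
    have hcong : ∀ t ∈ B.erase x, ∀ f ∈ triEdges t, Function.update w' e z f = w' f :=
      fun t ht f hf => Function.update_of_ne (fun h : f = e => hnot t ht (h ▸ hf)) _ _
    refine ⟨Function.update w' e z, fun t ht => ?_, fun t ht f hf => ?_⟩
    · by_cases htx : t = x
      · rw [htx, hz]
      · have htx' := Finset.mem_erase.2 ⟨htx, ht⟩
        rw [circ_congr (hcong t htx'), hw' t htx']
    · rw [hcong t (hDx ht) f hf, hww' t ht f hf]

lemma exists_antiderivative (f : ℤ → ℤ) : ∃ F : ℤ → ℤ, F 0 = 0 ∧ ∀ x, F (x + 1) - F x = f x := by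
  refine ⟨fun x => ∑ i ∈ Finset.Ico 0 x, f i - ∑ i ∈ Finset.Ico x 0, f i, by simp, fun x => ?_⟩
  rcases le_or_gt 0 x with hx | hx
  · have h1 : Finset.Ico x 0 = ∅ := Finset.Ico_eq_empty (by omega)
    have h2 : Finset.Ico (x + 1) 0 = ∅ := Finset.Ico_eq_empty (by omega)
    have h3 : Finset.Ico 0 (x + 1) = insert x (Finset.Ico 0 x) := by ext i; simp; omega
    simp only [h1, h2, h3]
    rw [Finset.sum_insert (by simp)]
    simp
  · have h1 : Finset.Ico 0 x = ∅ := Finset.Ico_eq_empty (by omega)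
    have h2 : Finset.Ico 0 (x + 1) = ∅ := Finset.Ico_eq_empty (by omega)
    have h3 : Finset.Ico x 0 = insert x (Finset.Ico (x + 1) 0) := by ext i; simp; omega
    simp only [h1, h2, h3]
    rw [Finset.sum_insert (by simp)]
    simp

/-- A function on edges without circulation on a rhombus, or on the whole grid, is there the
increment of a function on vertices. -/
lemma exists_inc_eq {w : Edge → ℤ} {S : Set Vertex}
    (hS : ∀ x y, (x, y) ∈ S → ∀ y', (0 ≤ y' ∧ y' ≤ y ∨ y ≤ y' ∧ y' ≤ 0) → (x, y') ∈ S)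
    (hw : ∀ v ∈ S, ∀ b, circ w (v, b) = 0) :
    ∃ h : Vertex → ℤ, ∀ v ∈ S, ∀ b, ∀ e ∈ triEdges (v, b), inc h e = w e := by
  obtain ⟨F, -, hF⟩ := exists_antiderivative fun x => w ((x, 0), 0)
  choose G hG0 hG using fun x => exists_antiderivative fun y => w ((x, y), 1)
  -- Integrate along the row of ordinate `0`, then along columns. Increments in direction `1` are
  -- right by construction; those in direction `0` pass from row to row through pairs of triangles
  -- (`hsq`), staying in `S` by `hS`.
  set h : Vertex → ℤ := fun v => F v.1 + G v.1 v.2 with hh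
  have h1 : ∀ v, inc h (v, 1) = w (v, 1) := by
    rintro ⟨x, y⟩
    rw [← hG x y]
    simp [inc, hh, dir]
  have h0 : ∀ x, inc h ((x, 0), 0) = w ((x, 0), 0) := fun x => by
    rw [← hF x]
    simp [inc, hh, dir, hG0]
  have hsq : ∀ x y, (x, y) ∈ S → inc h ((x, y + 1), 0) - inc h ((x, y), 0) =
      w ((x, y + 1), 0) - w ((x, y), 0) := fun x y hxy => by
    have a1 := hw _ hxy false
    have a2 := hw _ hxy true
    have a3 := sum_inc_triEdge h ((x, y), false)
    have a4 := sum_inc_triEdge h ((x, y), true)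
    have a5 := h1 (x, y)
    have a6 := h1 (x + 1, y)
    simp only [circ, triEdge, dir, Matrix.cons_val_zero, Matrix.cons_val_one, Matrix.cons_val,
      Prod.mk_add_mk, add_zero] at a1 a2 a3 a4
    omega
  have hup : ∀ x y : ℤ, 0 ≤ y → (∀ y', 0 ≤ y' → y' < y → (x, y') ∈ S) →
      inc h ((x, y), 0) = w ((x, y), 0) := fun x y hy => by
    induction y, hy using Int.leInduction with
    | base => exact fun _ => h0 x
    | succ y hy ih =>
      intro hxy
      have a1 := ih fun y' h1 h2 => hxy y' h1 (by omega)
      have a2 := hsq x y (hxy y hy (by omega))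
      omega
  have hdown : ∀ x y : ℤ, y ≤ 0 → (∀ y', y ≤ y' → y' < 0 → (x, y') ∈ S) →
      inc h ((x, y), 0) = w ((x, y), 0) := fun x y hy => by
    induction y, hy using Int.leInductionDown with
    | base => exact fun _ => h0 x
    | pred y hy ih =>
      intro hxy
      have a1 := ih fun y' h1 h2 => hxy y' (by omega) h2
      have a2 := hsq x (y - 1) (hxy (y - 1) le_rfl (by omega))
      simp only [sub_add_cancel] at a2
      omega
  refine ⟨h, fun v hv b e he => ?_⟩
  obtain ⟨x, y⟩ := v
  have b0 : inc h ((x, y), 0) = w ((x, y), 0) := by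
    rcases le_total 0 y with hy | hy
    · exact hup x y hy fun y' h1 h2 => hS x y hv y' (by omega)
    · exact hdown x y hy fun y' h1 h2 => hS x y hv y' (by omega)
  have b1 : inc h ((x, y + 1), 0) = w ((x, y + 1), 0) := by
    have := hsq x y hv
    omega
  have b2 := h1 (x, y)
  have b3 := h1 (x + 1, y)
  have a1 := hw _ hv b
  have a2 := sum_inc_triEdge h ((x, y), b)
  cases b <;>
  · simp only [circ, triEdge, dir, Matrix.cons_val_zero, Matrix.cons_val_one, Matrix.cons_val,
      Prod.mk_add_mk, add_zero] at a1 a2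
    simp only [triEdges, dir, Matrix.cons_val_zero, Matrix.cons_val_one, Prod.mk_add_mk,
      add_zero, Finset.mem_insert, Finset.mem_singleton] at he
    rcases he with rfl | rfl | rfl <;> omega

/-- The prescribed increments have no circulation on `D`; they are extended to a rhombus containing
`D` and integrated there. -/
lemma IsPolygon.exists_isHeight (hD : IsPolygon D) (T : Tiling D) : ∃ h, T.IsHeight h := by
  obtain ⟨N, hN⟩ : ∃ N : ℕ, ∀ t ∈ D, t.1.1.natAbs ≤ N ∧ t.1.2.natAbs ≤ N := by
    refine ⟨D.sup fun t => max t.1.1.natAbs t.1.2.natAbs, fun t ht => ?_⟩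
    rw [← max_le_iff]
    exact Finset.le_sup (f := fun t : Tri => max t.1.1.natAbs t.1.2.natAbs) ht
  set B : Domain := (Finset.Icc (-N : ℤ) N ×ˢ Finset.Icc (-N : ℤ) N) ×ˢ Finset.univ with hB
  have hDB : D ⊆ B := fun t ht => by
    have := hN t ht
    simp only [hB, Finset.mem_product, Finset.mem_Icc, Finset.mem_univ, and_true]
    omega
  set w : Edge → ℤ := fun e => if e ∈ T.lozenges then -2 else 1 with hw
  have hcirc : ∀ t ∈ D, circ w t = 0 := by
    intro t ht
    obtain ⟨l, ⟨hl, hlt⟩, huniq⟩ := T.cover t ht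
    have h1 : ∀ i, w (triEdge t i) = if i = l.2 then -2 else 1 := fun i => by
      rw [mem_triEdges_iff] at hlt
      simp only [hw]
      congr 1
      refine propext ⟨fun h => ?_, fun h => by rwa [h, ← hlt]⟩
      rw [← huniq _ ⟨h, triEdge_mem t i⟩, triEdge_snd]
    rw [circ, h1, h1, h1]
    generalize l.2 = j
    fin_cases j <;> simp
  obtain ⟨w', hw', hww'⟩ := exists_extension hD.2 hcirc _ B hDB rfl
  obtain ⟨h, hh⟩ := exists_inc_eq (w := w')
    (S := {v | v ∈ Finset.Icc (-N : ℤ) N ×ˢ Finset.Icc (-N : ℤ) N})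
    (by
      intro x y hxy y' hy'
      simp only [Finset.mem_product, Finset.mem_Icc, Set.mem_ofPred_eq] at hxy ⊢
      omega)
    (fun v hv b => hw' _ (Finset.mem_product.2 ⟨hv, Finset.mem_univ b⟩))
  refine ⟨h, Tiling.isHeight_iff.2 fun t ht e he => ?_⟩
  rw [hh t.1 (Finset.mem_product.1 (hDB ht)).1 t.2 e he, hww' t ht e he]

/-- The difference of the increments of two tilings, extended by `0` outside `D`, has no circulation
on the whole grid. Its potential `g` is constant on the connected complement, hence on the contour,
and subtracting that constant normalizes the heights. -/
lemma IsPolygon.hasConsistentHeights (hD : IsPolygon D) : HasConsistentHeights D := by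
  classical
  intro T T'
  obtain ⟨h, hT⟩ := hD.exists_isHeight T
  obtain ⟨h', hT'⟩ := hD.exists_isHeight T'
  set w : Edge → ℤ := fun e => if ∃ t ∈ D, e ∈ triEdges t then inc h' e - inc h e else 0 with hw
  have hwD : ∀ t ∈ D, ∀ e ∈ triEdges t, w e = inc h' e - inc h e := fun t ht e he =>
    if_pos ⟨t, ht, he⟩
  have hwout : ∀ t, t ∉ D → ∀ e ∈ triEdges t, w e = 0 := by
    intro t ht e he
    simp only [hw]
    split_ifs with hex
    · obtain ⟨s, hs, hes⟩ := hex
      have hc := isContourEdge_of_mem_of_notMem hes he hs ht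
      rw [hT.inc_eq hs hes, hT'.inc_eq hs hes, if_neg (T.notMem_of_isContourEdge hc),
        if_neg (T'.notMem_of_isContourEdge hc)]
      rfl
    · rfl
  have hcirc : ∀ t, circ w t = 0 := by
    intro t
    by_cases ht : t ∈ D
    · have h1 := sum_inc_triEdge h t
      have h2 := sum_inc_triEdge h' t
      rw [circ, hwD t ht _ (triEdge_mem t 0), hwD t ht _ (triEdge_mem t 1),
        hwD t ht _ (triEdge_mem t 2)]
      omega
    · rw [circ, hwout t ht _ (triEdge_mem t 0), hwout t ht _ (triEdge_mem t 1),
        hwout t ht _ (triEdge_mem t 2)]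
      rfl
  obtain ⟨g, hg⟩ := exists_inc_eq (S := Set.univ) (fun _ _ _ _ _ => Set.mem_univ _)
    (fun v _ b => hcirc (v, b))
  have hg' : ∀ t, ∀ e ∈ triEdges t, inc g e = w e := fun t => hg t.1 (Set.mem_univ _) t.2
  have hconst : ∀ t, t ∉ D → ∀ i j, g (triEdge t i).1 = g (triEdge t j).1 := by
    rintro ⟨⟨x, y⟩, b⟩ ht
    have h0 := fun i => hg' _ _ (triEdge_mem ((x, y), b) i)
    have h1 := fun i => hwout _ ht _ (triEdge_mem ((x, y), b) i)
    have a := h0 0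
    have b' := h0 1
    have c := h0 2
    rw [h1] at a b' c
    have key : g (triEdge ((x, y), b) 0).1 = g (triEdge ((x, y), b) 1).1 ∧
        g (triEdge ((x, y), b) 0).1 = g (triEdge ((x, y), b) 2).1 := by
      cases b <;> simp [inc, triEdge, dir] at a b' c ⊢ <;> omega
    intro i j
    fin_cases i <;> fin_cases j <;> simp only [Fin.zero_eta, Fin.mk_one, Fin.reduceFinMk] <;> omega
  have hconst' : ∀ t, t ∉ D → ∀ u ∈ triVertices t, ∀ u' ∈ triVertices t, g u = g u' := by
    intro t ht u hu u' hu'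
    obtain ⟨i, rfl⟩ := exists_triEdge_fst hu
    obtain ⟨j, rfl⟩ := exists_triEdge_fst hu'
    exact hconst t ht i j
  obtain ⟨t₀, ht₀⟩ := Infinite.exists_notMem_finset D
  have hall : ∀ t, Relation.ReflTransGen
      (fun x y : Tri => x ∉ D ∧ y ∉ D ∧ ∃ e, e ∈ triEdges x ∧ e ∈ triEdges y) t₀ t →
      ∀ u ∈ triVertices t, g u = g (triEdge t₀ 0).1 := by
    intro t ht
    induction ht with
    | refl =>
      exact fun u hu => hconst' t₀ ht₀ u hu _ (fst_mem_triVertices (triEdge_mem t₀ 0))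
    | tail _ hxy ih =>
      obtain ⟨-, hy, e, hex, hey⟩ := hxy
      intro u hu
      rw [hconst' _ hy u hu _ (fst_mem_triVertices hey), ih _ (fst_mem_triVertices hex)]
  refine ⟨h, fun v => h v + g v - g (triEdge t₀ 0).1, hT, Tiling.isHeight_iff.2 fun t ht e he => ?_,
    fun v hv => ?_⟩
  · have h1 := hg' t e he
    rw [hwD t ht e he] at h1
    rw [← hT'.inc_eq ht he]
    simp only [inc] at h1 ⊢
    omega
  · obtain ⟨t, ht, hvt⟩ := hv.exists_notMem
    have := hall t (hD.2 t₀ ht₀ t ht) v hvt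
    show h v = h v + g v - g (triEdge t₀ 0).1
    omega

/-! ### Gluing tilings -/

/-- `Q` is a subdomain which is a union of lozenges of `T`. -/
def Tiling.Saturates (T : Tiling D) (Q : Domain) : Prop :=
  Q ⊆ D ∧ ∀ t ∈ Q, ∀ l ∈ T.lozenges, l ∈ triEdges t → LozengeIn l Q

lemma Tiling.exists_restrict {T : Tiling D} {Q : Domain} (hQ : T.Saturates Q) :
    ∃ S : Tiling Q, ∀ l, l ∈ S.lozenges ↔ l ∈ T.lozenges ∧ LozengeIn l Q := by
  classical
  refine ⟨⟨T.lozenges.filter fun l => LozengeIn l Q, fun l hl => (Finset.mem_filter.1 hl).2,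
    fun t ht => ?_⟩, fun l => Finset.mem_filter⟩
  obtain ⟨l, ⟨hl, hlt⟩, hu⟩ := T.cover t (hQ.1 ht)
  exact ⟨l, ⟨Finset.mem_filter.2 ⟨hl, hQ.2 t ht l hl hlt⟩, hlt⟩, fun l' hl' =>
    hu l' ⟨(Finset.mem_filter.1 hl'.1).1, hl'.2⟩⟩

/-- Disjoint unions of lozenges of a tiling can be retiled independently. -/
lemma Tiling.exists_glue {T : Tiling D} {ι : Type*} {Q : ι → Domain} (hQ : ∀ i, T.Saturates (Q i))
    (hdisj : ∀ i j t, t ∈ Q i → t ∈ Q j → i = j) (U : ∀ i, Tiling (Q i)) :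
    ∃ T' : Tiling D, ∀ l, l ∈ T'.lozenges ↔
      (l ∈ T.lozenges ∧ ∀ i, ¬ LozengeIn l (Q i)) ∨ ∃ i, l ∈ (U i).lozenges := by
  classical
  have hsub : ∀ l, ((l ∈ T.lozenges ∧ ∀ i, ¬ LozengeIn l (Q i)) ∨ ∃ i, l ∈ (U i).lozenges) →
      LozengeIn l D := by
    rintro l (⟨hl, -⟩ | ⟨i, hl⟩)
    · exact T.subset l hl
    · exact fun t ht => (hQ i).1 ((U i).subset l hl t ht)
  have hmem : ∀ l, l ∈ (D.biUnion triEdges).filter (fun l =>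
      (l ∈ T.lozenges ∧ ∀ i, ¬ LozengeIn l (Q i)) ∨ ∃ i, l ∈ (U i).lozenges) ↔
      ((l ∈ T.lozenges ∧ ∀ i, ¬ LozengeIn l (Q i)) ∨ ∃ i, l ∈ (U i).lozenges) := by
    intro l
    rw [Finset.mem_filter, and_iff_right_iff_imp]
    intro hl
    exact Finset.mem_biUnion.2 ⟨_, hsub l hl _ (mem_triEdges_edgeTri l false),
      mem_triEdges_edgeTri l false⟩
  refine ⟨⟨_, fun l hl => hsub l ((hmem l).1 hl), fun t ht => ?_⟩, hmem⟩
  simp only [hmem]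
  by_cases hi : ∃ i, t ∈ Q i
  · obtain ⟨i, hi⟩ := hi
    obtain ⟨l, ⟨hl, hlt⟩, hu⟩ := (U i).cover t hi
    refine ⟨l, ⟨Or.inr ⟨i, hl⟩, hlt⟩, ?_⟩
    rintro l' ⟨⟨hl', hn⟩ | ⟨j, hl'⟩, hlt'⟩
    · exact absurd ((hQ i).2 t hi l' hl' hlt') (hn i)
    · obtain rfl := hdisj i j t hi ((U j).subset l' hl' t hlt')
      exact hu l' ⟨hl', hlt'⟩
  · push Not at hi
    obtain ⟨l, ⟨hl, hlt⟩, hu⟩ := T.cover t ht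
    refine ⟨l, ⟨Or.inl ⟨hl, fun i h => hi i (h t hlt)⟩, hlt⟩, ?_⟩
    rintro l' ⟨⟨hl', hn⟩ | ⟨j, hl'⟩, hlt'⟩
    · exact hu l' ⟨hl', hlt'⟩
    · exact absurd ((U j).subset l' hl' t hlt') (hi j)

lemma Tiling.mem_iff_of_subset {Q : Domain} {S : Tiling Q} {T : Tiling D}
    (hS : S.lozenges ⊆ T.lozenges) (hQ : Q ⊆ D) {t : Tri} (ht : t ∈ Q) {e : Edge}
    (he : e ∈ triEdges t) : e ∈ S.lozenges ↔ e ∈ T.lozenges := by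
  refine ⟨fun h => hS h, fun h => ?_⟩
  obtain ⟨l, ⟨hl, hlt⟩, -⟩ := S.cover t ht
  rwa [T.eq_of_mem (hQ ht) h (hS hl) he hlt]

/-- Retiling disjoint unions of lozenges upwards gives a greater tiling. -/
lemma Tiling.le_of_glue {T T' : Tiling D} {ι : Type*} {Q : ι → Domain}
    (hQ : ∀ i, T.Saturates (Q i)) (hdisj : ∀ i j t, t ∈ Q i → t ∈ Q j → i = j)
    {S U : ∀ i, Tiling (Q i)} (hS : ∀ i, (S i).lozenges ⊆ T.lozenges) (hle : ∀ i, S i ≤ U i)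
    (hU : ∀ i, (U i).lozenges ⊆ T'.lozenges)
    (hout : ∀ l ∈ T.lozenges, (∀ i, ¬ LozengeIn l (Q i)) → l ∈ T'.lozenges)
    {h : Vertex → ℤ} (hT : T.IsHeight h) : T ≤ T' := by
  classical
  choose k k' hk hk' hc hkle using hle
  -- `g` is the total correction of heights. Distinct `Q i` may touch at a vertex, so only vertices
  -- surrounded by a single `Q i` are corrected; the default `0` is right elsewhere because `k i`
  -- and `k' i` agree on the contour of `Q i`.
  set g : Vertex → ℤ := fun w =>
    if hw : ∃ i, ∀ t, w ∈ triVertices t → t ∈ Q i then k' hw.choose w - k hw.choose w else 0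
    with hg
  have hg1 : ∀ i w, (∀ t, w ∈ triVertices t → t ∈ Q i) → g w = k' i w - k i w := by
    intro i w hw
    have hex : ∃ i, ∀ t, w ∈ triVertices t → t ∈ Q i := ⟨i, hw⟩
    have hi : hex.choose = i := hdisj _ _ (w, false) (hex.choose_spec _ (by simp [triVertices]))
      (hw _ (by simp [triVertices]))
    simp only [hg]
    rw [dif_pos hex, hi]
  have hg2 : ∀ w, (¬ ∃ i, ∀ t, w ∈ triVertices t → t ∈ Q i) → g w = 0 := fun w hw => dif_neg hw
  have hg3 : ∀ i w, IsVertexOf (Q i) w → g w = k' i w - k i w := by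
    intro i w hw
    by_cases hcw : IsContourVertex (Q i) w
    · rw [← hc i w hcw, sub_self]
      refine hg2 w ?_
      rintro ⟨j, hj⟩
      obtain ⟨t, ht, hwt⟩ := hw
      obtain rfl := hdisj i j t ht (hj t hwt)
      obtain ⟨s, hs, hws⟩ := hcw.exists_notMem
      exact hs (hj s hws)
    · exact hg1 i w fun t ht => mem_of_not_isContourVertex hw hcw ht
  have hg4 : ∀ w, 0 ≤ g w := fun w => by
    by_cases hw : ∃ i, ∀ t, w ∈ triVertices t → t ∈ Q i
    · obtain ⟨i, hi⟩ := hw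
      rw [hg1 i w hi, sub_nonneg]
      exact hkle i w ⟨(w, false), hi _ (by simp [triVertices]), by simp [triVertices]⟩
    · rw [hg2 w hw]
  refine ⟨h, fun w => h w + g w, hT, Tiling.isHeight_iff.2 fun t ht e he => ?_, fun w hw => ?_,
    fun w _ => ?_⟩
  · have h0 := hT.inc_eq ht he
    by_cases hi : ∃ i, t ∈ Q i
    · obtain ⟨i, hi⟩ := hi
      have h1 := (hk i).inc_eq hi he
      have h2 := (hk' i).inc_eq hi he
      simp only [Tiling.mem_iff_of_subset (hS i) (hQ i).1 hi he] at h1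
      simp only [Tiling.mem_iff_of_subset (hU i) (hQ i).1 hi he] at h2
      rw [← h2]
      rw [← h1] at h0
      simp only [inc] at h0 ⊢
      rw [hg3 i _ ⟨t, hi, fst_mem_triVertices he⟩, hg3 i _ ⟨t, hi, snd_mem_triVertices he⟩]
      omega
    · have hz : ∀ w ∈ triVertices t, g w = 0 := fun w hw =>
        hg2 w fun ⟨j, hj⟩ => hi ⟨j, hj t hw⟩
      have hmem : e ∈ T.lozenges ↔ e ∈ T'.lozenges := by
        have hout' : ∀ l ∈ T.lozenges, l ∈ triEdges t → l ∈ T'.lozenges := fun l hl hlt =>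
          hout l hl fun i h => hi ⟨i, h t hlt⟩
        refine ⟨fun h => hout' e h he, fun h => ?_⟩
        obtain ⟨l, ⟨hl, hlt⟩, -⟩ := T.cover t ht
        rwa [T'.eq_of_mem ht h (hout' l hl hlt) he hlt]
      simp only [← hmem, ← h0, inc]
      rw [hz _ (fst_mem_triVertices he), hz _ (snd_mem_triVertices he)]
      omega
  · show h w = h w + g w
    rw [hg2 w, add_zero]
    rintro ⟨i, hi⟩
    obtain ⟨s, hs, hws⟩ := hw.exists_notMem
    exact hs ((hQ i).1 (hi s hws))
  · show h w ≤ h w + g w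
    have := hg4 w
    omega

/-! ### Base lozenges and ranges -/

lemma point_eq (v : Vertex) (q : Fin 3 → ℕ) :
    point v q = (v.1 + q 0 - q 2, v.2 + q 1 - q 2) := by
  ext <;> simp [point, Fin.sum_univ_three, dir] <;> ring

lemma point_eq_add (v : Vertex) (q : Fin 3 → ℕ) : point v q = v + point 0 q := by simp [point]

lemma point_zero (v : Vertex) : point v 0 = v := by simp [point]

lemma point_update (v : Vertex) (q : Fin 3 → ℕ) (k : Fin 3) (m : ℕ) :
    point v (Function.update q k m) = point v q + ((m : ℤ) - q k) • dir k := by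
  rw [point_eq, point_eq]
  fin_cases k <;> ext <;> simp [dir] <;> ring

lemma point_sub (v : Vertex) {q q' : Fin 3 → ℕ} (h : q' ≤ q) :
    point v (q - q') + point 0 q' = point v q := by
  simp only [point_eq, Pi.sub_apply, Nat.cast_sub (h _)]
  ext <;> simp <;> ring

/-- Two of the three directions form a basis of the lattice. -/
lemma point_injective {v : Vertex} {i : Fin 3} {q q' : Fin 3 → ℕ} (hq : q i = 0) (hq' : q' i = 0)
    (h : point v q = point v q') : q = q' := by
  rw [point_eq, point_eq, Prod.mk.injEq] at h
  ext j
  fin_cases i <;> fin_cases j <;>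
    simp only [Fin.zero_eta, Fin.mk_one, Fin.reduceFinMk] at * <;> omega

/-- The lozenges `(point v q - dir i, i)` with `q i = 0` form a tiling of the plane: every
triangle is covered. -/
lemma exists_sector (v : Vertex) (t : Tri) :
    ∃ i q, q i = 0 ∧ (point v q - dir i, i) ∈ triEdges t := by
  obtain ⟨a, b⟩ := v
  obtain ⟨⟨x, y⟩, c⟩ := t
  by_cases h0 : a ≤ x ∧ b ≤ y
  · refine ⟨2, ![(x - a).toNat, (y - b).toNat, 0], rfl, ?_⟩
    rw [point_eq]
    cases c <;> simp [triEdges, dir] <;> omega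
  · cases c
    · by_cases h1 : x - a < y - b
      · refine ⟨0, ![0, (y - b - (x - a) - 1).toNat, (a - x - 1).toNat], rfl, ?_⟩
        rw [point_eq]
        simp [triEdges, dir]; omega
      · refine ⟨1, ![(x - a - (y - b)).toNat, 0, (b - y - 1).toNat], rfl, ?_⟩
        rw [point_eq]
        simp [triEdges, dir]; omega
    · by_cases h1 : x - a ≤ y - b
      · refine ⟨0, ![0, (y - b - (x - a)).toNat, (a - x - 1).toNat], rfl, ?_⟩
        rw [point_eq]
        simp [triEdges, dir]; omega
      · refine ⟨1, ![(x - a - (y - b) - 1).toNat, 0, (b - y - 1).toNat], rfl, ?_⟩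
        rw [point_eq]
        simp [triEdges, dir]; omega

/-- The lozenges `(point v q - dir i, i)` with `q i = 0` form a tiling of the plane: no
triangle is covered twice. -/
lemma sector_unique {v : Vertex} {t : Tri} {i i' : Fin 3} {q q' : Fin 3 → ℕ} (hq : q i = 0)
    (hq' : q' i' = 0) (h : (point v q - dir i, i) ∈ triEdges t)
    (h' : (point v q' - dir i', i') ∈ triEdges t) : i = i' ∧ q = q' := by
  have hi : i = i' := by
    obtain ⟨a, b⟩ := v
    obtain ⟨⟨x, y⟩, c⟩ := t
    rw [point_eq] at h h'
    fin_cases i <;> fin_cases i' <;> first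
      | rfl
      | (exfalso
         cases c <;> simp [triEdges, dir] at h h' hq hq' <;> omega)
  subst hi
  refine ⟨rfl, point_injective (v := v) hq hq' ?_⟩
  rw [mem_triEdges_iff] at h h'
  have := h.trans h'.symm
  simpa using this

/-- Since `-dir i` is the sum of the other two directions, the whole lozenge lies in the cone that
they span from `point v q`. -/
lemma exists_ge_of_mem_triVertices {v : Vertex} {t : Tri} {i : Fin 3} {q : Fin 3 → ℕ} (hq : q i = 0)
    (h : (point v q - dir i, i) ∈ triEdges t) {u : Vertex} (hu : u ∈ triVertices t) :
    ∃ q', q ≤ q' ∧ q' i = 0 ∧ point v q' = u := by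
  have key : ∃ d : Fin 3 → ℕ, d i = 0 ∧ point v q + point 0 d = u := by
    generalize point v q = w at h
    obtain ⟨a, b⟩ := w
    obtain ⟨⟨x, y⟩, c⟩ := t
    obtain ⟨m, n⟩ := u
    refine ⟨![![0, (n - b - (m - a)).toNat, (a - m).toNat], ![(m - a - (n - b)).toNat, 0,
      (b - n).toNat], ![(m - a).toNat, (n - b).toNat, 0]] i, by fin_cases i <;> rfl, ?_⟩
    rw [point_eq]
    fin_cases i <;> cases c <;> simp [triEdges, triVertices, dir] at h hu ⊢ <;> omega
  obtain ⟨d, hd, rfl⟩ := key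
  refine ⟨q + d, fun j => by simp, by simp [hq, hd], ?_⟩
  rw [← point_sub v (q := q + d) (q' := d) (fun j => by simp)]
  simp

/-- The lozenges of the pseudo-hexagons of `T` with seed at `v`. -/
def Tiling.baseSet (T : Tiling D) (v : Vertex) : Set Lozenge :=
  {l | ∃ P, T.HasPseudoHexagon v P ∧ l ∈ baseLozenges v P}

lemma Tiling.mem_range {T : Tiling D} {v : Vertex} {t : Tri} :
    t ∈ T.range v ↔ t ∈ D ∧ ∃ l ∈ T.baseSet v, l ∈ triEdges t := by
  simp only [Tiling.range, Finset.mem_filter, Tiling.baseSet, Set.mem_ofPred_eq]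
  constructor
  · rintro ⟨ht, P, hP, l, hl, hlt⟩
    exact ⟨ht, l, ⟨P, hP, hl⟩, hlt⟩
  · rintro ⟨ht, l, ⟨P, hP, hl⟩, hlt⟩
    exact ⟨ht, P, hP, l, hl, hlt⟩

lemma Tiling.baseSet_subset {T : Tiling D} {v : Vertex} : T.baseSet v ⊆ T.lozenges := by
  rintro l ⟨P, hP, hl⟩
  exact hP.2 hl

lemma Tiling.lozengeIn_range {T : Tiling D} {v : Vertex} {l : Lozenge} (hl : l ∈ T.baseSet v) :
    LozengeIn l (T.range v) := fun t ht =>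
  Tiling.mem_range.2 ⟨T.subset l (Tiling.baseSet_subset hl) t ht, l, hl, ht⟩

lemma Tiling.mem_baseSet_of_mem_range {T : Tiling D} {v : Vertex} {t : Tri} (ht : t ∈ T.range v)
    {l : Lozenge} (hl : l ∈ T.lozenges) (hlt : l ∈ triEdges t) : l ∈ T.baseSet v := by
  obtain ⟨htD, l', hl', hlt'⟩ := Tiling.mem_range.1 ht
  rwa [T.eq_of_mem htD hl (Tiling.baseSet_subset hl') hlt hlt']

lemma Tiling.saturates_range (T : Tiling D) (v : Vertex) : T.Saturates (T.range v) :=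
  ⟨fun _ ht => (Tiling.mem_range.1 ht).1, fun _ ht _ hl hlt =>
    Tiling.lozengeIn_range (Tiling.mem_baseSet_of_mem_range ht hl hlt)⟩

/-- Every base lozenge has the form `(point v q - dir i, i)` for a cube `q` of the pile with
`q i = 0`. -/
lemma exists_of_mem_baseLozenges {v : Vertex} {P : Finset (Fin 3 → ℕ)} (hP : IsCompactPile P)
    {l : Lozenge} (hl : l ∈ baseLozenges v P) :
    ∃ q ∈ P, ∃ i, q i = 0 ∧ l = (point v q - dir i, i) := by
  obtain ⟨p, hp, i, rfl⟩ := hl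
  refine ⟨Function.update p i 0, hP.2 (fun j => ?_) hp, i, by simp, rfl⟩
  by_cases h : j = i
  · subst h; simp
  · simp [h]

lemma mem_baseLozenges {v : Vertex} {P : Finset (Fin 3 → ℕ)} {q : Fin 3 → ℕ} (hq : q ∈ P)
    {i : Fin 3} (hqi : q i = 0) : (point v q - dir i, i) ∈ baseLozenges v P :=
  ⟨q, hq, i, by rw [← hqi, Function.update_eq_self]⟩

/-- Piles are lower sets, so in each sector the base set is closed downwards. -/
lemma Tiling.mem_baseSet_of_le {T : Tiling D} {v : Vertex} {i : Fin 3} {q q' : Fin 3 → ℕ}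
    (h : (point v q - dir i, i) ∈ T.baseSet v) (hq : q i = 0) (hle : q' ≤ q) :
    (point v q' - dir i, i) ∈ T.baseSet v := by
  obtain ⟨P, hP, hl⟩ := h
  obtain ⟨r, hr, j, hrj, hl⟩ := exists_of_mem_baseLozenges hP.1 hl
  rw [Prod.mk.injEq] at hl
  obtain ⟨hl, rfl⟩ := hl
  obtain rfl := point_injective hq hrj (sub_left_injective hl)
  exact ⟨P, hP, mem_baseLozenges (hP.1.2 hle hr) (Nat.le_zero.1 ((hle i).trans hq.le))⟩

/-- The unit pile at a seed. -/
lemma Tiling.HasSeed.hasPseudoHexagon {T : Tiling D} {v : Vertex} (hs : T.HasSeed v) :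
    T.HasPseudoHexagon v {0} := by
  refine ⟨⟨Finset.singleton_nonempty 0, ?_⟩, ?_⟩
  · intro p q hqp hp
    simp only [Finset.coe_singleton, Set.mem_singleton_iff] at hp ⊢
    subst hp
    exact le_antisymm hqp (fun j => Nat.zero_le _)
  · rintro l ⟨p, hp, i, rfl⟩
    rw [Finset.mem_singleton] at hp
    subst hp
    have : Function.update (0 : Fin 3 → ℕ) i 0 = 0 := Function.update_eq_self i _
    rw [this, point_zero]
    exact hs i

lemma Tiling.HasSeed.mem_baseSet {T : Tiling D} {v : Vertex} (hs : T.HasSeed v) (i : Fin 3) :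
    (v - dir i, i) ∈ T.baseSet v :=
  ⟨{0}, hs.hasPseudoHexagon, by
    have := mem_baseLozenges (v := v) (Finset.mem_singleton_self (0 : Fin 3 → ℕ)) (i := i) rfl
    rwa [point_zero] at this⟩

/-- If two pseudo-hexagons share a lozenge, its coordinates from the two seeds are compared. A
strict inequality puts a lozenge of direction `i` from one base just before a lozenge of another
direction in `T`, which `Tiling.not_consecutive` forbids. Applied both ways, this gives equal
coordinates and hence equal seeds. -/
lemma le_of_base_overlap {T : Tiling D} {v v' : Vertex} (hs : T.HasSeed v')
    {P P' : Finset (Fin 3 → ℕ)} (hP : T.HasPseudoHexagon v P) (hP' : T.HasPseudoHexagon v' P')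
    {q q' : Fin 3 → ℕ} (hq : q ∈ P) (hq' : q' ∈ P') {i : Fin 3} (hqi : q i = 0) (hqi' : q' i = 0)
    (h : point v q = point v' q') {j : Fin 3} (hj : j ≠ i) : q j ≤ q' j := by
  by_contra! hlt
  by_cases hle : q' ≤ q
  · have h1 : point v (q - q') = v' := by
      have h1 := point_sub v hle
      rw [h, point_eq_add v' q'] at h1
      exact add_right_cancel h1
    -- Here `v'` lies in the base of `P`, and `r` is one step before it in direction `j`; the
    -- lozenge at `r` collides with the lozenge of direction `j` of the seed `v'`.
    set r := Function.update (q - q') j ((q - q') j - 1) with hr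
    have hrq : r ≤ q := by
      intro k
      by_cases hk : k = j
      · subst hk; simp [hr]; omega
      · simp [hr, hk]
    have h2 : point v r = v' - dir j := by
      rw [hr, point_update, h1, Nat.cast_sub (by simp only [Pi.sub_apply]; omega)]
      simp [sub_eq_add_neg]
    have h3 := hP.2 (mem_baseLozenges (v := v) (hP.1.2 hrq hq)
      (Nat.le_zero.1 ((hrq i).trans hqi.le)))
    rw [h2] at h3
    exact T.not_consecutive hj.symm h3 (hs j)
  · obtain ⟨k, hk⟩ : ∃ k, q k < q' k := by
      rw [Pi.le_def] at hle
      push Not at hle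
      exact hle
    have hki : k ≠ i := by
      rintro rfl
      omega
    have h1 : Function.update q k 0 ≤ q := by
      intro m
      by_cases hm : m = k
      · subst hm; simp
      · simp [hm]
    have h2 := hP.2 (mem_baseLozenges (v := v) (i := k) (hP.1.2 h1 hq) (by simp))
    -- Going back `q k` steps from the common point reaches the wall of `P` orthogonal to `k`; one
    -- more step stays in the base of `P'`, as `q k < q' k`, and gives the collision.
    set r := Function.update q' k (q' k - (q k + 1)) with hr
    have hrq : r ≤ q' := by
      intro m
      by_cases hm : m = k
      · subst hm; simp [hr]
      · simp [hr, hm]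
    have h3 := hP'.2 (mem_baseLozenges (v := v') (hP'.1.2 hrq hq')
      (Nat.le_zero.1 ((hrq i).trans hqi'.le)))
    have h4 : point v' r = point v (Function.update q k 0) - dir k := by
      rw [hr, point_update, point_update, ← h, Nat.cast_sub hk, add_sub_assoc]
      congr 1
      push_cast
      module
    rw [h4] at h3
    exact T.not_consecutive hki.symm h3 h2

/-- The ranges of distinct seeds are disjoint. -/
lemma Tiling.HasSeed.eq_of_mem_range {T : Tiling D} {v v' : Vertex} (hs : T.HasSeed v)
    (hs' : T.HasSeed v') {t : Tri} (ht : t ∈ T.range v) (ht' : t ∈ T.range v') : v = v' := by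
  obtain ⟨l, ⟨hl, hlt⟩, -⟩ := T.cover t (Tiling.mem_range.1 ht).1
  obtain ⟨P, hP, h⟩ := Tiling.mem_baseSet_of_mem_range ht hl hlt
  obtain ⟨P', hP', h'⟩ := Tiling.mem_baseSet_of_mem_range ht' hl hlt
  obtain ⟨q, hq, i, hqi, rfl⟩ := exists_of_mem_baseLozenges hP.1 h
  obtain ⟨q', hq', i', hqi', heq⟩ := exists_of_mem_baseLozenges hP'.1 h'
  rw [Prod.mk.injEq] at heq
  obtain ⟨heq, rfl⟩ := heq
  replace heq := sub_left_injective heq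
  have hqq : q = q' := by
    ext j
    by_cases hj : j = i
    · rw [hj, hqi, hqi']
    · exact (le_of_base_overlap hs' hP hP' hq hq' hqi hqi' heq hj).antisymm
        (le_of_base_overlap hs hP' hP hq' hq hqi' hqi heq.symm hj)
  subst hqq
  rw [point_eq_add v, point_eq_add v'] at heq
  exact add_right_cancel heq

/-- Walk away from `v` inside the sector, in a direction `j ≠ i`. The walk stays off the base set,
which is closed downwards, so the edges crossed have the same increments for both tilings. A
difference of heights would persist without ever meeting the contour, which is impossible in a
finite domain. -/
lemma Tiling.eq_of_notMem_baseSet {T : Tiling D} {v : Vertex} {TA TB : Tiling D}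
    (hAB : ∀ t ∈ D, t ∉ T.range v → ∀ e ∈ triEdges t, e ∈ TA.lozenges ↔ e ∈ TB.lozenges)
    {hA hB : Vertex → ℤ} (hTA : TA.IsHeight hA) (hTB : TB.IsHeight hB)
    (hc : AgreeOnContour D hA hB) {i : Fin 3} {q : Fin 3 → ℕ} (hq : q i = 0)
    (hn : (point v q - dir i, i) ∉ T.baseSet v) (hv : IsVertexOf D (point v q)) :
    hA (point v q) = hB (point v q) := by
  obtain ⟨j, hj⟩ := exists_ne i
  by_contra hne
  refine not_of_walk (D := D) j (fun u => IsVertexOf D u ∧ hA u ≠ hB u ∧ ∃ q, q i = 0 ∧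
    (point v q - dir i, i) ∉ T.baseSet v ∧ point v q = u) ?_ (point v q)
    ⟨hv, hne, q, hq, hn, rfl⟩
  rintro _ ⟨hu, hne, q, hq, hn, rfl⟩
  obtain ⟨t, h1, h2⟩ := exists_tri_of_consecutive (point v q) hj.symm
  have htD : t ∈ D :=
    mem_of_not_isContourVertex hu (fun h => hne (hc _ h)) (fst_mem_triVertices h2)
  have htr : t ∉ T.range v := by
    intro htr
    obtain ⟨-, l, hl, hlt⟩ := Tiling.mem_range.1 htr
    obtain ⟨P, hP, hlP⟩ := id hl
    obtain ⟨q', -, i', hqi', rfl⟩ := exists_of_mem_baseLozenges hP.1 hlP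
    obtain ⟨rfl, rfl⟩ := sector_unique hq hqi' h1 hlt
    exact hn hl
  have h3 := hTA.inc_eq htD h2
  simp only [hAB t htD htr _ h2] at h3
  rw [← hTB.inc_eq htD h2] at h3
  simp only [inc] at h3
  have hqle : q ≤ Function.update q j (q j + 1) := by
    intro m
    by_cases hm : m = j
    · subst hm; simp
    · simp [hm]
  have hq' : Function.update q j (q j + 1) i = 0 := by
    rw [Function.update_of_ne hj.symm, hq]
  refine ⟨hu, ⟨t, htD, snd_mem_triVertices h2⟩, by omega, Function.update q j (q j + 1), hq',
    fun h => hn (Tiling.mem_baseSet_of_le h hq' hqle), ?_⟩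
  rw [point_update]
  simp

/-- The ranges have consistent heights. -/
lemma HasConsistentHeights.range (hD : HasConsistentHeights D) (T : Tiling D) (v : Vertex) :
    HasConsistentHeights (T.range v) := by
  have hQ := T.saturates_range v
  intro A B
  obtain ⟨TA, hTA⟩ := Tiling.exists_glue (ι := Unit) (fun _ => hQ) (fun _ _ _ _ _ => rfl)
    (fun _ => A)
  obtain ⟨TB, hTB⟩ := Tiling.exists_glue (ι := Unit) (fun _ => hQ) (fun _ _ _ _ _ => rfl)
    (fun _ => B)
  simp only [forall_const, exists_const] at hTA hTB
  obtain ⟨hA, hB, hhA, hhB, hc⟩ := hD TA TB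
  have hAsub : A.lozenges ⊆ TA.lozenges := fun l hl => (hTA l).2 (Or.inr hl)
  have hBsub : B.lozenges ⊆ TB.lozenges := fun l hl => (hTB l).2 (Or.inr hl)
  have hAB : ∀ t ∈ D, t ∉ T.range v → ∀ e ∈ triEdges t, e ∈ TA.lozenges ↔ e ∈ TB.lozenges := by
    intro t _ htr e he
    rw [hTA, hTB, or_iff_left fun h => htr (A.subset e h t he),
      or_iff_left fun h => htr (B.subset e h t he)]
  refine ⟨hA, hB, Tiling.isHeight_iff.2 fun t ht e he => ?_,
    Tiling.isHeight_iff.2 fun t ht e he => ?_, fun u hu => ?_⟩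
  · simp only [Tiling.mem_iff_of_subset hAsub hQ.1 ht he, hhA.inc_eq (hQ.1 ht) he]
  · simp only [Tiling.mem_iff_of_subset hBsub hQ.1 ht he, hhB.inc_eq (hQ.1 ht) he]
  · have huD : IsVertexOf D u := by
      obtain ⟨t, ht, hut⟩ := hu.isVertexOf
      exact ⟨t, hQ.1 ht, hut⟩
    obtain ⟨t, ht, hut⟩ := hu.exists_notMem
    -- The vertex touches a triangle `t` outside the range; in the sector of `t` its coordinates
    -- dominate those of `t`, hence are off the base set.
    obtain ⟨i, q, hq, hqt⟩ := exists_sector v t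
    obtain ⟨q', hle, hq', rfl⟩ := exists_ge_of_mem_triVertices hq hqt hut
    refine Tiling.eq_of_notMem_baseSet hAB hhA hhB hc hq' (fun h => ht ?_) huD
    exact Tiling.lozengeIn_range (Tiling.mem_baseSet_of_le h hq' hle) t hqt

/-! ### Maximal fillings -/

lemma mem_maxRange_self {T : Tiling D} {v : Vertex} (hs : T.HasSeed v) {h : Vertex → ℤ}
    (hT : T.IsHeight h) : (v, h v) ∈ maxRange D h (v, h v) :=
  ⟨T, h, hT, fun _ _ => rfl, rfl, {0}, hs.hasPseudoHexagon, 0, Finset.mem_singleton_self 0, by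
    simp [point_zero]⟩

/-- In a maximum range the seed is the only cube of least height. -/
lemma eq_of_mem_maxRange {h : Vertex → ℤ} {s s' : Cube} (h1 : s ∈ maxRange D h s')
    (h2 : s' ∈ maxRange D h s) : s = s' := by
  obtain ⟨-, -, -, -, -, -, -, p, -, hp⟩ := h1
  obtain ⟨-, -, -, -, -, -, -, p', -, hp'⟩ := h2
  have e1 := congrArg Prod.snd hp
  have e2 := congrArg Prod.snd hp'
  have n1 : 0 ≤ ∑ j, (p j : ℤ) := Finset.sum_nonneg fun _ _ => by positivity
  have n2 : 0 ≤ ∑ j, (p' j : ℤ) := Finset.sum_nonneg fun _ _ => by positivity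
  simp only at e1 e2
  have hz : ∑ j, (p j : ℤ) = 0 := by omega
  have hp0 : p = 0 := by
    ext j
    have := (Finset.sum_eq_zero_iff_of_nonneg fun i _ => Int.natCast_nonneg (p i)).1 hz j
      (Finset.mem_univ j)
    exact_mod_cast this
  rw [hp, hp0]
  simp [point_zero]

/-- Take a seed whose maximum range is maximal for inclusion. A seed whose range contains this one
has the same range, so each seed lies in the range of the other and they coincide. -/
lemma Tiling.exists_hasProperSeed {T : Tiling D} {h : Vertex → ℤ} (hT : T.IsHeight h)
    (hs : ∃ v, T.HasSeed v) : ∃ v, T.HasProperSeed v := by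
  have hfin : {v | T.HasSeed v}.Finite := by
    refine (D.biUnion triVertices).finite_toSet.subset fun v hv => ?_
    obtain ⟨t, ht, hvt⟩ := Tiling.HasSeed.isVertexOf hv
    simp only [Finset.coe_biUnion, Set.mem_iUnion]
    exact ⟨t, ht, hvt⟩
  obtain ⟨v, hv, hmax⟩ := hfin.exists_maximalFor (fun v => maxRange D h (v, h v)) _ hs
  refine ⟨v, hv, h, hT, fun v' hv' hle => ?_⟩
  have h1 := hle (mem_maxRange_self hv hT)
  have h2 := hmax hv' hle (mem_maxRange_self hv' hT)
  exact congrArg Prod.fst (eq_of_mem_maxRange h2 h1)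

lemma Tiling.nonempty_range (T : Tiling D) (v : Vertex) : Nonempty (Tiling (T.range v)) :=
  ⟨(Tiling.exists_restrict (T.saturates_range v)).choose⟩

lemma Tiling.HasProperSeed.eq_of_mem_range {T : Tiling D}
    (v v' : {v // T.HasProperSeed v}) (t : Tri) (h : t ∈ T.range v) (h' : t ∈ T.range v') :
    v = v' :=
  Subtype.ext (v.2.1.eq_of_mem_range v'.2.1 h h')

lemma HasConsistentHeights.exists_isMaxFilling (hD : HasConsistentHeights D) (T : Tiling D) :
    ∃ T' : Tiling D, T.IsMaxFilling T' := by
  have hU : ∀ v, ∃ U : Tiling (T.range v), U.IsMaximal := fun v =>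
    have := T.nonempty_range v
    (hD.range T v).exists_isMaximal
  choose U hU using hU
  obtain ⟨T', hT'⟩ := Tiling.exists_glue (ι := {v // T.HasProperSeed v})
    (fun v => T.saturates_range v) Tiling.HasProperSeed.eq_of_mem_range (fun v => U v)
  refine ⟨T', fun v hv => ⟨U v, hU v, fun l hl => (hT' l).2 (Or.inr ⟨⟨v, hv⟩, hl⟩)⟩,
    fun l hl hn => (hT' l).2 (Or.inl ⟨hl, fun v => hn v v.2⟩)⟩

lemma Tiling.IsMaxFilling.unique {T T' T'' : Tiling D} (h' : T.IsMaxFilling T')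
    (h'' : T.IsMaxFilling T'') : T' = T'' := by
  refine Tiling.eq_of_subset fun l hl => ?_
  obtain ⟨t, ht, hlt⟩ := T'.exists_tri hl
  by_cases hv : ∃ v, T.HasProperSeed v ∧ t ∈ T.range v
  · obtain ⟨v, hv, htv⟩ := hv
    obtain ⟨U, hU, hUT⟩ := h'.1 v hv
    obtain ⟨U', hU', hUT'⟩ := h''.1 v hv
    obtain rfl := hU.eq hU'
    obtain ⟨m, ⟨hm, hmt⟩, -⟩ := U.cover t htv
    rw [T'.eq_of_mem ht hl (hUT hm) hlt hmt]
    exact hUT' hm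
  · push Not at hv
    obtain ⟨m, ⟨hm, hmt⟩, -⟩ := T.cover t ht
    have hn : ∀ v, T.HasProperSeed v → ¬ LozengeIn m (T.range v) := fun v hv' h =>
      hv v hv' (h t hmt)
    rw [T'.eq_of_mem ht hl (h'.2 m hm hn) hlt hmt]
    exact h''.2 m hm hn

/-- On each range, the restriction of `T` is below the maximal tiling, and the ranges are disjoint.
-/
lemma Tiling.IsMaxFilling.le (hD : HasConsistentHeights D) {T T' : Tiling D}
    (h : T.IsMaxFilling T') : T ≤ T' := by
  choose S hS using fun v : {v // T.HasProperSeed v} =>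
    Tiling.exists_restrict (T.saturates_range v)
  choose U hU hUT using fun v : {v // T.HasProperSeed v} => h.1 v v.2
  obtain ⟨k, hk⟩ := hD.exists_isHeight T
  exact Tiling.le_of_glue (ι := {v // T.HasProperSeed v}) (fun v => T.saturates_range v)
    Tiling.HasProperSeed.eq_of_mem_range
    (fun v l hl => ((hS v l).1 hl).1) (fun v => hU v (S v)) hUT
    (fun l hl hn => h.2 l hl fun v hv => hn ⟨v, hv⟩) hk

lemma Tiling.IsMaxFilling.ne (hD : HasConsistentHeights D) {T T' : Tiling D}
    (h : T.IsMaxFilling T') (hT : ¬ T.IsMaximal) : T ≠ T' := by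
  rintro rfl
  have hs : ∃ v, T.HasSeed v := by
    by_contra! hs
    exact hT (isMaximal_of_not_hasSeed hD hs)
  obtain ⟨k, hk⟩ := hD.exists_isHeight T
  obtain ⟨v, hv⟩ := Tiling.exists_hasProperSeed hk hs
  obtain ⟨U, hU, hUT⟩ := h.1 v hv
  -- If the filling changed nothing, the maximal tiling of the range would still contain the seed at
  -- `v`.
  refine hU.not_hasSeed (hD.range T v) v fun i => ?_
  have hin := Tiling.lozengeIn_range (hv.1.mem_baseSet i) _
    (mem_triEdges_edgeTri (v - dir i, i) false)
  rw [Tiling.mem_iff_of_subset hUT (T.saturates_range v).1 hin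
    (mem_triEdges_edgeTri (v - dir i, i) false)]
  exact hv.1 i

/-! ### The filling sequence and its chain of intervals. -/

lemma HasConsistentHeights.existsUnique_isFillingSequence (hD : HasConsistentHeights D)
    [Nonempty (Tiling D)] : ∃! E : ℕ → Tiling D, IsFillingSequence E := by
  obtain ⟨T₀, hT₀⟩ := hD.exists_isMinimal
  choose f hf using hD.exists_isMaxFilling
  refine ⟨fun n => f^[n] T₀, ⟨hT₀, fun n => ?_⟩, fun E hE => funext fun n => ?_⟩
  · simp only [Function.iterate_succ_apply']
    exact hf _
  · induction n with
    | zero => exact hE.1.eq hT₀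
    | succ n ih =>
      have := hE.2 n
      rw [ih] at this
      simp only [Function.iterate_succ_apply']
      exact this.unique (hf _)

lemma isMaxChain_of_filling (hD : HasConsistentHeights D) {E : ℕ → Tiling D} {d : ℕ}
    (hmin : (E 0).IsMinimal) (hmax : (E d).IsMaximal) (hle : ∀ n, E n ≤ E (n + 1))
    (hne : ∀ n < d, E n ≠ E (n + 1)) :
    IsMaxChain TilingInterval.Precedes
      {I : TilingInterval D | ∃ n < d, I.lo = E n ∧ I.hi = E (n + 1)} := by
  let := hD.partialOrder
  have hmono : Monotone E := monotone_nat_of_le_succ hle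
  have hmono' : ∀ {m n}, m ≤ n → E m ≤ E n := fun h => hmono h
  have hext : ∀ {I J : TilingInterval D}, I.lo = J.lo → I.hi = J.hi → I = J := by
    rintro ⟨_, _, _, _⟩ ⟨_, _, _, _⟩ rfl rfl
    rfl
  refine ⟨?_, fun C hC hsub => hsub.antisymm fun J hJ => ?_⟩
  · rintro I ⟨m, -, hm, hm'⟩ J ⟨n, -, hn, hn'⟩ hIJ
    simp only [TilingInterval.Precedes]
    rw [hm, hm', hn, hn']
    rcases lt_trichotomy m n with h | h | h
    · exact Or.inl (hmono' h)
    · subst h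
      exact absurd (hext (hm.trans hn.symm) (hm'.trans hn'.symm)) hIJ
    · exact Or.inr (hmono' h)
  · by_contra hJn
    have key : ∀ n < d, J.hi ≤ E n ∨ E (n + 1) ≤ J.lo := by
      intro n hn
      have hmem : (⟨E n, E (n + 1), hle n, hne n hn⟩ : TilingInterval D) ∈ C :=
        hsub ⟨n, hn, rfl, rfl⟩
      refine hC hJ hmem ?_
      rintro rfl
      exact hJn ⟨n, hn, rfl, rfl⟩
    -- An additional interval `J` is pushed upwards: once `E n ≤ J.lo`, the alternative `J.hi ≤ E n`
    -- would reduce `J` to a point. At `n = d` it is squeezed above `Max`.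
    have hlo : ∀ n ≤ d, E n ≤ J.lo := by
      intro n
      induction n with
      | zero => exact fun _ => hmin J.lo
      | succ n ih =>
        intro hn
        refine (key n hn).resolve_left fun h => ?_
        exact J.ne (Tiling.le_antisymm' J.le (Tiling.le_trans' h (ih (by omega))))
    exact J.ne (Tiling.le_antisymm' J.le (Tiling.le_trans' (hmax J.hi) (hlo d le_rfl)))

/-- A sequence that never reached `Max` would increase strictly forever in a finite set. -/
lemma HasConsistentHeights.exists_isLeast (hD : HasConsistentHeights D) {E : ℕ → Tiling D}
    (hE : IsFillingSequence E) : ∃ d : ℕ, IsLeast {n | (E n).IsMaximal} d := by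
  classical
  have hex : ∃ n, (E n).IsMaximal := by
    by_contra! hcon
    let := hD.partialOrder
    have hlt : StrictMono E := strictMono_nat_of_lt_succ fun n =>
      lt_of_le_of_ne ((hE.2 n).le hD) ((hE.2 n).ne hD (hcon n))
    exact not_injective_infinite_finite E hlt.injective
  exact ⟨Nat.find hex, Nat.find_spec hex, fun n hn => Nat.find_min' hex hn⟩

end LozengeTiling

open LozengeTiling
theorem mainTheorem6 (D : Domain) (hT : Nonempty (Tiling D))
    (hD : IsPolygon D ∨ HasConsistentHeights D) :
    (∃! E : ℕ → Tiling D, IsFillingSequence E) ∧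
    ∀ E : ℕ → Tiling D, IsFillingSequence E →
      ∃ d : ℕ, IsLeast {n | (E n).IsMaximal} d ∧
        (E 0).IsMinimal ∧ (E d).IsMaximal ∧
        (∀ n < d, E n ≤ E (n + 1) ∧ E n ≠ E (n + 1)) ∧
        IsMaxChain TilingInterval.Precedes
          {I : TilingInterval D | ∃ n < d, I.lo = E n ∧ I.hi = E (n + 1)} := by
  have hC : HasConsistentHeights D := hD.elim IsPolygon.hasConsistentHeights id
  refine ⟨hC.existsUnique_isFillingSequence, fun E hE => ?_⟩
  obtain ⟨d, hd⟩ := hC.exists_isLeast hE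
  have hle : ∀ n, E n ≤ E (n + 1) := fun n => (hE.2 n).le hC
  have hne : ∀ n < d, E n ≠ E (n + 1) := fun n hn =>
    (hE.2 n).ne hC fun h => absurd (hd.2 h) (not_le.2 hn)
  exact ⟨d, hd, hE.1, hd.1, fun n hn => ⟨hle n, hne n hn⟩,
    isMaxChain_of_filling hC hE.1 hd.1 hle hne⟩
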